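/- Let $\Sigma$ be a finite signed graph, i.e. a finite graph (loops and multiple edges allowed) with vertices $v_1,\dots,v_n$, each of whose edges $e$ carries a sign $\operatorname{sgn}(e)\in\{+1,-1\}$. A proper coloring of $\Sigma$ is a function $\kappa$ from the vertices to $\mathbb Z$ such that $\kappa(u)\neq \operatorname{sgn}(e)\,\kappa(v)$ for every edge $e$ with endpoints $u,v$. The chromatic $B$-symmetric function of $\Sigma$ is the formal power series $$X_\Sigma=\sum_{\kappa\ \text{proper}} x_{\kappa(v_1)}x_{\kappa(v_2)}\cdots x_{\kappa(v_n)}\in\mathbb Q[[x_i : i\in\mathbb Z]].$$ An orientation of $\Sigma$ assigns to each half-edge an arrow pointing toward or away from its vertex, such that on a positive edge exactly one of the two arrows points toward its vertex and on a negative edge either both or neither do. A cycle of an orientation is a closed walk such that every vertex in the walk has at least one arrow pointing into it and at least one arrow pointing out of it, when only the edges in the walk are considered; an orientation is acyclic if it has no cycles. A sink is a vertex that has only arrows pointing toward it (in particular, an isolated vertex is a sink). Put $e_n=\sum_{i_1<\dots<i_n}x_{i_1}\cdots x_{i_n}$ (sum over integers $i_1<\dots<i_n$), $p_{a,b}=\sum_{i\in\mathbb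 Z}x_i^a x_{-i}^b$, $q_{a,b}=(-1)^{a+b+1}p_{a,b}$ and $z=-x_0$. The augmented elementary $B$-symmetric basis consists of the $e_n$ with $n\ge 1$, the $q_{a,b}$ with $a,b\ge 1$, and $z$; since $q_{a,b}=q_{b,a}$, each $q_{a,b}$ is listed once, with $a\ge b\ge 1$. **Theorem.** The series $X_\Sigma$ can be written in exactly one way as a polynomial with rational coefficients in the elements of the augmented elementary $B$-symmetric basis. When it is so written, then for every integer $k\ge 0$ the number of acyclic orientations of $\Sigma$ with exactly $k$ sinks equals the sum of the coefficients of those monomials that have exactly $k$ factors (counted with multiplicity) among the $e_n$. -/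

import Mathlib

universe u v

/-- A signed graph with vertex set `V` and edge set `E`; loops and multiple edges are allowed.
Each edge `e` has two half-edges, labelled by `Bool`, and `ends e b` is the vertex at the
half-edge `b` of `e`. The labelling of the halves only serves to tell them apart. -/
structure SignedGraph (V : Type u) (E : Type v) where
  ends : E → Bool → V
  sgn : E → ℤˣ

namespace SignedGraph

variable {V : Type u} {E : Type v}

/-- The edge `e` has endpoints `u` and `w` (written `e : uw`). -/
def Joins (G : SignedGraph V E) (e : E) (u w : V) : Prop :=
  ∃ b : Bool, G.ends e b = u ∧ G.ends e (!b) = w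

/-- An orientation puts an arrow on every half-edge, pointing toward its vertex
(`toward e b = true`) or away from it (`toward e b = false`). On a positive edge the two arrows
have the same direction along the edge, so exactly one of them points toward its vertex; on a
negative edge they have opposite directions, so both or neither point toward their vertices. -/
structure Orientation (G : SignedGraph V E) where
  toward : E → Bool → Bool
  positive : ∀ e, G.sgn e = 1 → toward e false ≠ toward e true
  negative : ∀ e, G.sgn e = -1 → toward e false = toward e true

/-- A closed walk: vertices `vert 0, …, vert length = vert 0` with an edge between any two
consecutive ones. (The values `vert i` with `i > length` play no role.) -/
structure ClosedWalk (G : SignedGraph V E) where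
  length : ℕ
  vert : ℕ → V
  edge : Fin length → E
  joins : ∀ i : Fin length, G.Joins (edge i) (vert i) (vert (i + 1))
  closed : vert length = vert 0

/-- A closed walk is a cycle of the orientation `O` if each of its vertices has at least one arrow
pointing into it and at least one arrow pointing out of it, when only the edges in the walk are
considered. (A walk of length `0` is therefore never a cycle.) -/
def ClosedWalk.IsCycle {G : SignedGraph V E} (w : G.ClosedWalk) (O : G.Orientation) : Prop :=
  ∀ i ≤ w.length,
    (∃ (j : Fin w.length) (b : Bool),
      G.ends (w.edge j) b = w.vert i ∧ O.toward (w.edge j) b = true) ∧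
    (∃ (j : Fin w.length) (b : Bool),
      G.ends (w.edge j) b = w.vert i ∧ O.toward (w.edge j) b = false)

/-- An orientation is acyclic if it contains no cycles. -/
def Orientation.IsAcyclic {G : SignedGraph V E} (O : G.Orientation) : Prop :=
  ∀ w : G.ClosedWalk, ¬ w.IsCycle O

/-- A vertex is a sink if it has only arrows pointing toward it (so an isolated vertex is one). -/
def Orientation.IsSink {G : SignedGraph V E} (O : G.Orientation) (x : V) : Prop :=
  ∀ (e : E) (b : Bool), G.ends e b = x → O.toward e b = true

/-- There are finitely many orientations, so that counting them with `Nat.card` is meaningful. -/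
instance Orientation.instFinite [Finite E] (G : SignedGraph V E) : Finite G.Orientation :=
  Finite.of_injective (fun O : G.Orientation => O.toward) (by
    rintro ⟨s, _, _⟩ ⟨t, _, _⟩ h
    cases h
    rfl)

/-- The number of acyclic orientations of `G` with exactly `k` sinks. -/
noncomputable def numAcyclic (G : SignedGraph V E) (k : ℕ) : ℕ :=
  Nat.card {O : G.Orientation // O.IsAcyclic ∧ Nat.card {x : V // O.IsSink x} = k}

/-- A coloring `κ` by integers is proper if `κ u ≠ sgn e * κ w` for every edge `e : uw`. -/
def IsProper (G : SignedGraph V E) (κ : V → ℤ) : Prop :=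
  ∀ (e : E) (u w : V), G.Joins e u w → κ u ≠ (G.sgn e : ℤ) * κ w

end SignedGraph

namespace BSymmetric

/-- The formal sum `∑ i, x ^ f i` of the monomials `x ^ f i` in the variables `x_j`, `j ∈ ℤ`: the
coefficient of a monomial is the number of `i` that produce it. Used only for families in which
every monomial is produced finitely often. -/
noncomputable def monomialSum {ι : Type u} (f : ι → (ℤ →₀ ℕ)) : MvPowerSeries ℤ ℚ :=
  fun m => (Nat.card {i : ι // f i = m} : ℚ)

/-- `p_{a,b} = ∑_{i ∈ ℤ} x_i ^ a * x_{-i} ^ b` (for `(a, b) ≠ (0, 0)`). -/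
noncomputable def p (a b : ℕ) : MvPowerSeries ℤ ℚ :=
  monomialSum fun i : ℤ => Finsupp.single i a + Finsupp.single (-i) b

/-- `e_n = ∑_{i_1 < ⋯ < i_n} x_{i_1} ⋯ x_{i_n}`, a sum over the `n`-element subsets of `ℤ`. -/
noncomputable def e (n : ℕ) : MvPowerSeries ℤ ℚ :=
  monomialSum fun s : {s : Finset ℤ // s.card = n} => ∑ i ∈ s.1, Finsupp.single i 1

/-- `q_{a,b} = (-1) ^ (a + b + 1) * p_{a,b}`. -/
noncomputable def q (a b : ℕ) : MvPowerSeries ℤ ℚ :=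
  (-1) ^ (a + b + 1) * p a b

/-- `z = -x_0`. -/
noncomputable def z : MvPowerSeries ℤ ℚ :=
  -MvPowerSeries.X (0 : ℤ)

/-- Index set of the augmented elementary `B`-symmetric basis: `e_n` for `n ≥ 1`, `q_{a,b}` for
`a, b ≥ 1`, and `z`. Since `q_{a,b} = q_{b,a}`, each of the functions `q_{a,b}` is listed once,
namely with `a ≥ b`. -/
inductive Gen where
  | e (n : ℕ) (hn : 1 ≤ n) : Gen
  | q (a b : ℕ) (hb : 1 ≤ b) (hab : b ≤ a) : Gen
  | z : Gen

/-- The elements of the augmented elementary `B`-symmetric basis. -/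
noncomputable def Gen.toSeries : Gen → MvPowerSeries ℤ ℚ
  | .e n _ => BSymmetric.e n
  | .q a b _ _ => BSymmetric.q a b
  | .z => BSymmetric.z

/-- The number of factors `e_n` (with multiplicity, over all `n`) in a monomial in the basis. -/
def eFactors (m : Gen →₀ ℕ) : ℕ :=
  m.sum fun g j =>
    match g with
    | .e _ _ => j
    | .q _ _ _ _ => 0
    | .z => 0

/-- The sum of the coefficients of the monomials of `F` with exactly `k` factors `e_n`. -/
def coeffSum (F : MvPolynomial Gen ℚ) (k : ℕ) : ℚ :=
  ∑ m ∈ F.support with eFactors m = k, F.coeff m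

/-- Reversing the roles of the two indices does not change `p_{a,b}`. -/
theorem p_comm (a b : ℕ) : p a b = p b a := by
  funext m
  simp only [p, monomialSum]
  congr 1
  refine Nat.card_congr ((Equiv.neg ℤ).subtypeEquiv fun i => ?_)
  simp [add_comm]

/-- Every monomial occurs finitely often in the sum defining `p_{a,b}`, if `a ≥ 1`. -/
theorem finite_p (a b : ℕ) (ha : 1 ≤ a) (m : ℤ →₀ ℕ) :
    Finite {i : ℤ // Finsupp.single i a + Finsupp.single (-i) b = m} := by
  refine Set.Finite.subset (m.support.finite_toSet) fun i hi => ?_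
  have h : Finsupp.single i a + Finsupp.single (-i) b = m := hi
  simp only [Finset.mem_coe, Finsupp.mem_support_iff, ← h, Finsupp.add_apply,
    Finsupp.single_eq_same]
  omega

/-- Every monomial occurs finitely often in the sum defining `e_n`. -/
theorem finite_e (n : ℕ) (m : ℤ →₀ ℕ) :
    Finite {s : {s : Finset ℤ // s.card = n} // ∑ i ∈ s.1, Finsupp.single i 1 = m} := by
  refine Finite.of_injective
    (fun s => (⟨s.1.1, ?_⟩ : {t : Finset ℤ // t ∈ m.support.powerset})) ?_
  · rw [Finset.mem_powerset]
    intro i hi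
    rw [Finsupp.mem_support_iff, ← s.2, Finsupp.finsetSum_apply]
    refine (Finset.sum_pos' (fun _ _ => Nat.zero_le _) ⟨i, hi, ?_⟩).ne'
    simp
  · intro s t h
    have h' : s.1.1 = t.1.1 := by simpa using h
    exact Subtype.ext (Subtype.ext h')

end BSymmetric

namespace SignedGraph

variable {V : Type u} {E : Type v}

/-- The chromatic `B`-symmetric function: the sum over all proper colorings `κ` of the monomials
`x ^ κ = ∏_v x_{κ v}`. -/
noncomputable def chromaticB [Fintype V] (G : SignedGraph V E) : MvPowerSeries ℤ ℚ :=
  BSymmetric.monomialSum fun κ : {κ : V → ℤ // G.IsProper κ} =>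
    ∑ x : V, Finsupp.single (κ.1 x) 1

/-- Every monomial occurs finitely often in the sum defining the chromatic `B`-symmetric
function. -/
theorem finite_chromaticB [Fintype V] (G : SignedGraph V E) (m : ℤ →₀ ℕ) :
    Finite {κ : {κ : V → ℤ // G.IsProper κ} // ∑ x : V, Finsupp.single (κ.1 x) 1 = m} := by
  have key : ∀ (κ : V → ℤ), (∑ x : V, Finsupp.single (κ x) 1) = m → ∀ x, κ x ∈ m.support := by
    intro κ h x
    rw [Finsupp.mem_support_iff, ← h, Finsupp.finsetSum_apply]
    refine (Finset.sum_pos' (fun _ _ => Nat.zero_le _) ⟨x, Finset.mem_univ x, ?_⟩).ne'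
    simp
  refine Finite.of_injective
    (fun κ => (fun x => ⟨κ.1.1 x, key _ κ.2 x⟩ : V → {i : ℤ // i ∈ m.support})) ?_
  intro s t h
  refine Subtype.ext (Subtype.ext (funext fun x => ?_))
  exact Subtype.ext_iff.mp (congrFun h x)

end SignedGraph

/-!
The coefficient sums are read off from a specialization of the variables. Fix `t : ℚ` and `k : ℕ`,
and put `x_{k+1} = t - 1`, `x_i = -1` for `|i| ≤ k`, and all other variables equal to `0`. The
values of `e_n`, `q_{a,b}` and `z` are then polynomials in `N = 2 * k + 1`
(`hasValue_toSeries`), and at `N = -1` these polynomials take the values `t`, `1` and `1`. So if the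
chromatic function is written as a polynomial `F` in the basis, its value at this point, continued
to `N = -1`, is the sum of the coefficients of `F`, each multiplied by `t` to the number of its
factors `e_n` (`eval_specialPoly`).

On the other hand, sort the proper colorings of the graph `G` with values in `{-k, …, k + 1}` by the
set `U` of vertices of color `k + 1`. The color `-(k + 1)` does not occur, so that `U` only has to
contain no positive edge, and the other vertices form a coloring of `G \ U` with values in
`{-k, …, k}`. By Zaslavsky's theorem (`SignedPoint.exists_polynomial_boxCount`) the number of the
latter is a polynomial in `N`, whose value at `N = -1` is, up to the sign `(-1) ^ |V \ U|`, the
number of regions of the hyperplane arrangement of `G \ U`. The regions correspond to the acyclic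
orientations of `G \ U`, that is, to the acyclic orientations of `G` in which all vertices of `U` are
sinks (`SignedGraph.card_acyclic_sinks`). Therefore the continued value is the sum of
`(t - 1) ^ |U|` over all pairs of an acyclic orientation and a set `U` of sinks of it, which is the
sum of `t ^ (number of sinks)` over the acyclic orientations.

Zaslavsky's theorem and the existence of `F` (`SignedPoint.generatingFunction_mem`) are both proved
by deletion and contraction, for systems of constraints `α ≠ β` between signed points `0`, `± b`:
such systems are closed under solving an equation `α = β` for one of the unknowns, so that no
quotient graphs are needed. The link between regions and the combinatorial definition of acyclicity
is the existence of compatible potentials (`Orientation.isAcyclic_of_compatible` and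
`Orientation.IsAcyclic.exists_compatible`). The uniqueness of `F` is the algebraic independence of the
basis (`BSymmetric.aeval_toSeries_injective`). Newton's identities replace the `e_n` with the power
sums `p_{n,0}`. A polynomial relation between power sums would vanish at all sums of value vectors
of single pairs of variables, and those vectors span.
-/

universe w

namespace BSymmetric

/-! ### Sums of monomials -/

/-- Every monomial is produced finitely often by `f`, so that `monomialSum f` is the formal sum of
the monomials `x ^ f i` and no junk value of `Nat.card` enters. -/
def FiniteFibers {ι : Type u} (f : ι → (ℤ →₀ ℕ)) : Prop :=
  ∀ m, Finite {i // f i = m}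

theorem monomialSum_equiv {ι : Type u} {κ : Type v} (e : ι ≃ κ) {f : ι → (ℤ →₀ ℕ)}
    {g : κ → (ℤ →₀ ℕ)} (h : ∀ i, g (e i) = f i) : monomialSum f = monomialSum g := by
  funext m
  simp only [monomialSum]
  congr 1
  exact Nat.card_congr (e.subtypeEquiv fun i => by rw [h])

theorem FiniteFibers.comp {ι : Type u} {κ : Type v} {f : ι → (ℤ →₀ ℕ)} (hf : FiniteFibers f)
    {j : κ → ι} (hj : Function.Injective j) : FiniteFibers fun k => f (j k) := fun m => by
  have := hf m
  refine Finite.of_injective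
    (fun k : {k // f (j k) = m} => (⟨j k.1, k.2⟩ : {i // f i = m})) fun a b h => ?_
  exact Subtype.ext (hj (Subtype.ext_iff.mp h))

/-- Pairs producing the monomial `m`, sorted by the factorization of `m`. -/
def fiberProdEquiv {ι : Type u} {κ : Type v} (f : ι → (ℤ →₀ ℕ)) (g : κ → (ℤ →₀ ℕ))
    (m : ℤ →₀ ℕ) : {p : ι × κ // f p.1 + g p.2 = m} ≃
      Σ d : {d // d ∈ Finset.HasAntidiagonal.antidiagonal m}, {i // f i = d.1.1} × {j // g j = d.1.2} where
  toFun p := ⟨⟨(f p.1.1, g p.1.2), Finset.HasAntidiagonal.mem_antidiagonal.2 p.2⟩, ⟨p.1.1, rfl⟩, ⟨p.1.2, rfl⟩⟩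
  invFun x := ⟨(x.2.1.1, x.2.2.1), by
    rw [x.2.1.2, x.2.2.2]; exact Finset.HasAntidiagonal.mem_antidiagonal.1 x.1.2⟩
  left_inv _ := rfl
  right_inv := by
    rintro ⟨⟨⟨a, b⟩, h⟩, ⟨i, hi⟩, ⟨j, hj⟩⟩
    obtain rfl : f i = a := hi
    obtain rfl : g j = b := hj
    rfl

theorem FiniteFibers.prod {ι : Type u} {κ : Type v} {f : ι → (ℤ →₀ ℕ)} {g : κ → (ℤ →₀ ℕ)}
    (hf : FiniteFibers f) (hg : FiniteFibers g) :
    FiniteFibers fun p : ι × κ => f p.1 + g p.2 := fun m => by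
  have := hf
  have := hg
  simp only [FiniteFibers] at *
  exact Finite.of_equiv _ (fiberProdEquiv f g m).symm

theorem monomialSum_mul {ι : Type u} {κ : Type v} {f : ι → (ℤ →₀ ℕ)} {g : κ → (ℤ →₀ ℕ)}
    (hf : FiniteFibers f) (hg : FiniteFibers g) :
    monomialSum f * monomialSum g = monomialSum fun p : ι × κ => f p.1 + g p.2 := by
  classical
  ext m
  rw [MvPowerSeries.coeff_mul]
  change ∑ d ∈ Finset.HasAntidiagonal.antidiagonal m,
    (Nat.card {i // f i = d.1} : ℚ) * (Nat.card {j // g j = d.2} : ℚ) =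
      (Nat.card {p : ι × κ // f p.1 + g p.2 = m} : ℚ)
  have hf' := hf
  have hg' := hg
  simp only [FiniteFibers] at hf' hg'
  rw [Nat.card_congr (fiberProdEquiv f g m), Nat.card_sigma]
  simp only [Nat.card_prod]
  push_cast
  exact (Finset.sum_coe_sort (Finset.HasAntidiagonal.antidiagonal m) fun d =>
    (Nat.card {i // f i = d.1} : ℚ) * (Nat.card {j // g j = d.2} : ℚ)).symm

/-- Splitting a sum of monomials by a predicate on the index. -/
theorem monomialSum_split {ι : Type u} {f : ι → (ℤ →₀ ℕ)} (hf : FiniteFibers f) (P : ι → Prop) :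
    monomialSum f =
      monomialSum (fun i : {i // P i} => f i.1) + monomialSum fun i : {i // ¬ P i} => f i.1 := by
  classical
  funext m
  change (Nat.card {i // f i = m} : ℚ) = (Nat.card {i : {i // P i} // f i.1 = m} : ℚ) +
    (Nat.card {i : {i // ¬ P i} // f i.1 = m} : ℚ)
  have := hf m
  have := hf.comp (Subtype.val_injective (p := P)) m
  have := hf.comp (Subtype.val_injective (p := fun i => ¬ P i)) m
  rw [← Nat.cast_add, ← Nat.card_sum]
  congr 1
  exact Nat.card_congr
    { toFun := fun i => if h : P i.1 then .inl ⟨⟨i.1, h⟩, i.2⟩ else .inr ⟨⟨i.1, h⟩, i.2⟩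
      invFun := Sum.elim (fun i => ⟨i.1.1, i.2⟩) fun i => ⟨i.1.1, i.2⟩
      left_inv := fun i => by
        by_cases h : P i.1 <;> simp [h]
      right_inv := by
        rintro (⟨⟨i, h⟩, rfl⟩ | ⟨⟨i, h⟩, rfl⟩) <;> simp [h] }

/-- If every index is repeated `c` times, the sum is multiplied by `c`. -/
theorem monomialSum_sigma {ι : Type u} {f : ι → (ℤ →₀ ℕ)} (hf : FiniteFibers f)
    (β : ι → Type v) (c : ℕ) [∀ i, Finite (β i)] (hβ : ∀ i, Nat.card (β i) = c) :
    monomialSum (fun x : Σ i, β i => f x.1) = (c : ℚ) • monomialSum f := by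
  funext m
  change (Nat.card {x : Σ i, β i // f x.1 = m} : ℚ) = (c : ℚ) * (Nat.card {i // f i = m} : ℚ)
  have := hf m
  have := Fintype.ofFinite {i // f i = m}
  have e : {x : Σ i, β i // f x.1 = m} ≃ Σ i : {i // f i = m}, β i.1 :=
    { toFun := fun x => ⟨⟨x.1.1, x.2⟩, x.1.2⟩
      invFun := fun x => ⟨⟨x.1.1, x.2⟩, x.1.2⟩
      left_inv := fun _ => rfl
      right_inv := fun _ => rfl }
  rw [Nat.card_congr e, Nat.card_sigma]
  simp [hβ, mul_comm]

theorem monomialSum_unit (c : ℤ →₀ ℕ) :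
    monomialSum (fun _ : Unit => c) = MvPowerSeries.monomial c (1 : ℚ) := by
  classical
  ext m
  rw [MvPowerSeries.coeff_monomial]
  change (Nat.card {_x : Unit // c = m} : ℚ) = _
  by_cases h : m = c
  · subst h
    simp
  · have : IsEmpty {_x : Unit // c = m} := ⟨fun x => h x.2.symm⟩
    simp [h]

/-- A finite product of sums of monomials is a sum over the functions choosing an index in each
factor. -/
theorem monomialSum_pi {ι : Type v} (B : Type u) [Fintype B] :
    ∀ f : B → ι → (ℤ →₀ ℕ), (∀ b, FiniteFibers (f b)) →
      FiniteFibers (fun ψ : B → ι => ∑ b, f b (ψ b)) ∧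
      ∏ b, monomialSum (f b) = monomialSum fun ψ : B → ι => ∑ b, f b (ψ b) := by
  classical
  refine Fintype.induction_empty_option (P := fun B _ => ∀ f : B → ι → (ℤ →₀ ℕ),
    (∀ b, FiniteFibers (f b)) → FiniteFibers (fun ψ : B → ι => ∑ b, f b (ψ b)) ∧
      ∏ b, monomialSum (f b) = monomialSum fun ψ : B → ι => ∑ b, f b (ψ b)) ?_ ?_ ?_ B
  · intro α β _ e ih f hf
    let _ : Fintype α := Fintype.ofEquiv β e.symm
    obtain ⟨h1, h2⟩ := ih (fun a => f (e a)) fun a => hf _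
    have key : ∀ ψ : β → ι, ∑ a, f (e a) (ψ (e a)) = ∑ b, f b (ψ b) := fun ψ =>
      Equiv.sum_comp e fun b => f b (ψ b)
    constructor
    · have := h1.comp (e.arrowCongr (Equiv.refl ι)).symm.injective
      convert this using 2 with ψ
      exact (key ψ).symm
    · rw [← Equiv.prod_comp e fun b => monomialSum (f b), h2]
      refine monomialSum_equiv (e.arrowCongr (Equiv.refl ι)) fun ψ => ?_
      rw [← key]
      simp
  · intro f hf
    refine ⟨fun m => inferInstance, ?_⟩
    rw [Fintype.prod_empty, monomialSum_equiv (Equiv.equivPUnit (PEmpty → ι))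
      (g := fun _ : Unit => (0 : ℤ →₀ ℕ)) (by simp), monomialSum_unit]
    rfl
  · intro α _ ih f hf
    obtain ⟨h1, h2⟩ := ih (fun a => f (some a)) fun a => hf _
    constructor
    · convert ((hf none).prod h1).comp (Equiv.piOptionEquivProd (β := fun _ : Option α => ι)).injective
        using 2 with ψ
      simp [Fintype.sum_option]
    · rw [Fintype.prod_option, h2, monomialSum_mul (hf none) h1]
      refine (monomialSum_equiv (Equiv.piOptionEquivProd (β := fun _ : Option α => ι)) fun ψ => ?_).symm
      simp [Fintype.sum_option]

/-! ### Power sums and elementary functions -/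

theorem finiteFibers_p (a b : ℕ) (ha : 1 ≤ a) :
    FiniteFibers fun i : ℤ => Finsupp.single i a + Finsupp.single (-i) b := finite_p a b ha

theorem finiteFibers_e (n : ℕ) :
    FiniteFibers fun s : {s : Finset ℤ // s.card = n} => ∑ i ∈ s.1, Finsupp.single i 1 := finite_e n

/-- The sum of `x_i ^ a * x_{j_1} ⋯ x_{j_n}` over all integers `i` and all `n`-element sets
`{j_1, …, j_n}` not containing `i` (the monomial symmetric function of the hook partition
`(a, 1, …, 1)` if `a ≥ 2`). -/
noncomputable def hook (a n : ℕ) : MvPowerSeries ℤ ℚ :=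
  monomialSum fun x : {x : ℤ × Finset ℤ // x.1 ∉ x.2 ∧ x.2.card = n} =>
    Finsupp.single x.1.1 a + ∑ i ∈ x.1.2, Finsupp.single i 1

theorem e_zero : e 0 = 1 := by
  have : Unique {s : Finset ℤ // s.card = 0} :=
    ⟨⟨⟨∅, rfl⟩⟩, fun s => Subtype.ext (Finset.card_eq_zero.1 s.2)⟩
  rw [e, monomialSum_equiv (Equiv.ofUnique _ Unit) (g := fun _ : Unit => (0 : ℤ →₀ ℕ)) ?_,
    monomialSum_unit]
  · rfl
  · intro s
    rw [Finset.card_eq_zero.1 s.2]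
    rfl

theorem hook_zero (a : ℕ) : hook a 0 = p a 0 := by
  let j : {x : ℤ × Finset ℤ // x.1 ∉ x.2 ∧ x.2.card = 0} ≃ ℤ :=
    { toFun := fun x => x.1.1
      invFun := fun i => ⟨(i, ∅), by simp⟩
      left_inv := fun x => Subtype.ext (Prod.ext rfl (Finset.card_eq_zero.1 x.2.2).symm)
      right_inv := fun _ => rfl }
  refine monomialSum_equiv j fun x => ?_
  simp [Finset.card_eq_zero.1 x.2.2, j]

theorem hook_one (n : ℕ) : hook 1 n = ((n + 1 : ℕ) : ℚ) • e (n + 1) := by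
  rw [e, ← monomialSum_sigma (finiteFibers_e (n + 1)) (fun s => {i // i ∈ s.1}) (n + 1)
    fun s => by simpa using s.2]
  let j : {x : ℤ × Finset ℤ // x.1 ∉ x.2 ∧ x.2.card = n} ≃
      Σ s : {s : Finset ℤ // s.card = n + 1}, {i // i ∈ s.1} :=
    { toFun := fun x => ⟨⟨insert x.1.1 x.1.2, by
        rw [Finset.card_insert_of_notMem x.2.1, x.2.2]⟩, ⟨x.1.1, Finset.mem_insert_self _ _⟩⟩
      invFun := fun y => ⟨(y.2.1, y.1.1.erase y.2.1), Finset.notMem_erase _ _, by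
        simp [Finset.card_erase_of_mem y.2.2, y.1.2]⟩
      left_inv := by
        rintro ⟨⟨i, s⟩, h1, h2⟩
        simp [Finset.erase_insert h1]
      right_inv := by
        rintro ⟨⟨s, hs⟩, ⟨i, hi⟩⟩
        exact Sigma.subtype_ext (Subtype.ext (Finset.insert_erase hi)) rfl }
  refine monomialSum_equiv j fun x => ?_
  exact Finset.sum_insert x.2.1

/-- The index `i` of `p_a` either avoids or meets the set of a monomial of `e_{n + 1}`. -/
theorem p_mul_e (a n : ℕ) (ha : 1 ≤ a) :
    p a 0 * e (n + 1) = hook a (n + 1) + hook (a + 1) n := by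
  have hF := (finiteFibers_p a 0 ha).prod (finiteFibers_e (n + 1))
  rw [p, e, monomialSum_mul (finiteFibers_p a 0 ha) (finiteFibers_e (n + 1)),
    monomialSum_split hF fun x => x.1 ∉ x.2.1]
  congr 1
  · let j : {x : ℤ × {s : Finset ℤ // s.card = n + 1} // x.1 ∉ x.2.1} ≃
        {x : ℤ × Finset ℤ // x.1 ∉ x.2 ∧ x.2.card = n + 1} :=
      { toFun := fun x => ⟨(x.1.1, x.1.2.1), x.2, x.1.2.2⟩
        invFun := fun x => ⟨(x.1.1, ⟨x.1.2, x.2.2⟩), x.2.1⟩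
        left_inv := fun _ => rfl
        right_inv := fun _ => rfl }
    refine monomialSum_equiv j fun x => ?_
    simp [j]
  · let j : {x : ℤ × {s : Finset ℤ // s.card = n + 1} // ¬ x.1 ∉ x.2.1} ≃
        {x : ℤ × Finset ℤ // x.1 ∉ x.2 ∧ x.2.card = n} :=
      { toFun := fun x => ⟨(x.1.1, x.1.2.1.erase x.1.1), Finset.notMem_erase _ _, by
          rw [Finset.card_erase_of_mem (not_not.1 x.2), x.1.2.2]; rfl⟩
        invFun := fun x => ⟨(x.1.1, ⟨insert x.1.1 x.1.2, by
          rw [Finset.card_insert_of_notMem x.2.1, x.2.2]⟩), not_not.2 (Finset.mem_insert_self _ _)⟩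
        left_inv := by
          rintro ⟨⟨i, s, hs⟩, h⟩
          simp only [Finset.insert_erase (not_not.1 h)]
        right_inv := by
          rintro ⟨⟨i, s⟩, h1, h2⟩
          simp only [Finset.erase_insert h1] }
    refine monomialSum_equiv j fun x => ?_
    have h := Finset.add_sum_erase x.1.2.1 (fun i => Finsupp.single i 1) (not_not.1 x.2)
    simp only [j, Equiv.coe_fn_mk, Finsupp.single_zero, add_zero]
    rw [← h, ← add_assoc, ← Finsupp.single_add]

/-- **Newton's identities** for the symmetric functions in the variables `x_i`, `i ∈ ℤ`. -/
theorem newton_identity (n : ℕ) :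
    ((n + 1 : ℕ) : ℚ) • e (n + 1) =
      ∑ i ∈ Finset.range (n + 1), (-1) ^ i * e (n - i) * p (i + 1) 0 := by
  -- partial sums telescope
  have key : ∀ k ≤ n, ∑ i ∈ Finset.range k, (-1) ^ i * e (n - i) * p (i + 1) 0 =
      hook 1 n - (-1) ^ k * hook (k + 1) (n - k) := by
    intro k hk
    induction k with
    | zero => simp
    | succ k ih =>
      obtain ⟨d, hd⟩ : ∃ d, n = k + 1 + d := ⟨n - (k + 1), by omega⟩
      have h1 : n - k = d + 1 := by omega
      have h2 : n - (k + 1) = d := by omega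
      rw [Finset.sum_range_succ, ih (by omega), h1, h2, mul_assoc, mul_comm (e _),
        p_mul_e (k + 1) d (by omega), pow_succ]
      ring
  rw [Finset.sum_range_succ, key n le_rfl, ← hook_one, Nat.sub_self, hook_zero, e_zero]
  ring

/-! ### The subalgebra generated by the augmented elementary basis -/

/-- The subalgebra generated by the augmented elementary `B`-symmetric basis. -/
noncomputable def basisAlgebra : Subalgebra ℚ (MvPowerSeries ℤ ℚ) :=
  (MvPolynomial.aeval Gen.toSeries : MvPolynomial Gen ℚ →ₐ[ℚ] MvPowerSeries ℤ ℚ).range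

theorem toSeries_mem (g : Gen) : g.toSeries ∈ basisAlgebra :=
  ⟨MvPolynomial.X g, by simp⟩

theorem e_mem (n : ℕ) : e n ∈ basisAlgebra := by
  rcases n with _ | n
  · rw [e_zero]
    exact one_mem _
  · exact toSeries_mem (.e (n + 1) (by omega))

theorem hook_mem (a n : ℕ) : hook (a + 1) n ∈ basisAlgebra := by
  induction a generalizing n with
  | zero =>
    rw [hook_one]
    exact Subalgebra.smul_mem _ (e_mem _) _
  | succ a ih =>
    have h := p_mul_e (a + 1) n (by omega)
    rw [eq_sub_iff_add_eq'.2 h.symm, ← hook_zero]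
    exact sub_mem (mul_mem (ih 0) (e_mem _)) (ih _)

theorem p_mem (a b : ℕ) (hab : 1 ≤ a + b) : p a b ∈ basisAlgebra := by
  wlog h : b ≤ a generalizing a b
  · rw [p_comm]
    exact this b a (by omega) (by omega)
  rcases b with _ | b
  · obtain ⟨a, rfl⟩ : ∃ c, a = c + 1 := ⟨a - 1, by omega⟩
    rw [← hook_zero]
    exact hook_mem a 0
  · have h1 := toSeries_mem (.q a (b + 1) (by omega) h)
    have h2 : p a (b + 1) = (-1) ^ (a + (b + 1) + 1) * Gen.toSeries (.q a (b + 1) (by omega) h) := by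
      simp only [Gen.toSeries, q]
      rw [← mul_assoc, ← mul_pow]
      simp
    rw [h2]
    exact mul_mem (pow_mem (neg_mem (one_mem _)) _) h1

theorem X_zero_mem : (MvPowerSeries.X (0 : ℤ) : MvPowerSeries ℤ ℚ) ∈ basisAlgebra := by
  have h := neg_mem (toSeries_mem .z)
  simpa [Gen.toSeries, z] using h

end BSymmetric

/-! ### Systems of signed equations -/

/-- A signed point over `B`: one of the formal expressions `0` and `± b` with `b : B`. The
constraints of a signed graph, and all the constraints that arise from them by contraction of edges,
have the form `α ≠ β` with signed points `α` and `β`. -/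
abbrev SignedPoint (B : Type u) : Type u := Option (ℤˣ × B)

namespace SignedPoint

variable {ι : Type v} {B C : Type u}

/-- The value of a signed point at an assignment of integers to the elements of `B`. -/
def ev : SignedPoint B → (B → ℤ) → ℤ
  | none, _ => 0
  | some (ε, b), ψ => ε * ψ b

/-- Substitution of signed points over `C` for the elements of `B`. -/
def subst (σ : B → SignedPoint C) : SignedPoint B → SignedPoint C
  | none => none
  | some (ε, b) => (σ b).map fun x => (ε * x.1, x.2)

/-- The assignment on `B` induced by an assignment on `C`. -/
def pull (σ : B → SignedPoint C) (ψ : C → ℤ) : B → ℤ := fun b => ev (σ b) ψ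

theorem ev_subst (σ : B → SignedPoint C) (α : SignedPoint B) (ψ : C → ℤ) :
    ev (subst σ α) ψ = ev α (pull σ ψ) := by
  rcases α with _ | ⟨ε, b⟩
  · rfl
  · simp only [subst, ev, pull]
    rcases σ b with _ | ⟨δ, c⟩ <;> simp [mul_assoc]

theorem ev_comb (α : SignedPoint B) (M N : ℤ) (ψ ψ' : B → ℤ) :
    ev α (fun b => M * ψ b + N * ψ' b) = M * ev α ψ + N * ev α ψ' := by
  rcases α with _ | ⟨ε, b⟩ <;> simp only [ev] <;> ring

theorem abs_ev_le (α : SignedPoint B) {ψ : B → ℤ} {k : ℤ} (hk : 0 ≤ k) (h : ∀ b, |ψ b| ≤ k) :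
    |ev α ψ| ≤ k := by
  rcases α with _ | ⟨ε, b⟩
  · simpa [ev] using hk
  · rcases Int.units_eq_one_or ε with rfl | rfl <;> simpa [ev] using h b

theorem exists_solve {α β : SignedPoint B} (h : α ≠ β) :
    ∃ (b : B) (γ : SignedPoint {x // x ≠ b}),
      ∀ ψ : B → ℤ, ev α ψ = ev β ψ ↔ ψ b = ev γ fun x => ψ x := by
  rcases α with _ | ⟨ε, a⟩ <;> rcases β with _ | ⟨δ, b⟩
  · exact absurd rfl h
  · refine ⟨b, none, fun ψ => ?_⟩
    rcases Int.units_eq_one_or δ with rfl | rfl <;> simp [ev, eq_comm]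
  · refine ⟨a, none, fun ψ => ?_⟩
    rcases Int.units_eq_one_or ε with rfl | rfl <;> simp [ev]
  · by_cases hab : b = a
    · subst hab
      refine ⟨b, none, fun ψ => ?_⟩
      have hδ : δ = -ε := by
        rcases Int.units_eq_one_or ε with rfl | rfl <;>
          rcases Int.units_eq_one_or δ with rfl | rfl <;> simp at h ⊢
      rcases Int.units_eq_one_or ε with rfl | rfl <;> simp [hδ, ev] <;> omega
    · refine ⟨a, some (ε * δ, ⟨b, hab⟩), fun ψ => ?_⟩
      rcases Int.units_eq_one_or ε with rfl | rfl <;>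
        rcases Int.units_eq_one_or δ with rfl | rfl <;> simp [ev] <;> omega

/-- **Contraction.** The solutions of a nontrivial equation `α = β` are parametrized by the
assignments on a set with one element less. The condition on `σ` says that the parameters are
among the coordinates of the solution. -/
theorem exists_elim [Fintype B] {α β : SignedPoint B} (h : α ≠ β) :
    ∃ (C : Type u) (_ : Fintype C) (σ : B → SignedPoint C),
      Fintype.card B = Fintype.card C + 1 ∧ (∀ c, ∃ b, σ b = some (1, c)) ∧
        ∀ ψ, ev α ψ = ev β ψ ↔ ∃ ψ', pull σ ψ' = ψ := by
  classical
  obtain ⟨b, γ, hγ⟩ := exists_solve h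
  refine ⟨{x // x ≠ b}, inferInstance,
    fun x => if hx : x = b then γ else some (1, ⟨x, hx⟩), ?_, fun c => ⟨c, by simp [c.2]⟩,
    fun ψ => ?_⟩
  · have h1 : 0 < Fintype.card B := Fintype.card_pos_iff.2 ⟨b⟩
    have h2 := Fintype.card_subtype_compl fun x => x = b
    rw [Fintype.card_subtype_eq] at h2
    change Fintype.card {x // x ≠ b} = _ at h2
    omega
  · rw [hγ]
    constructor
    · intro hψ
      refine ⟨fun x => ψ x, funext fun x => ?_⟩
      by_cases hx : x = b
      · subst hx
        simp [pull, hψ]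
      · simp [pull, hx, ev]
    · rintro ⟨ψ', rfl⟩
      simp only [pull, dif_pos]
      congr 1
      funext x
      simp [x.2, ev]

theorem pull_injective {σ : B → SignedPoint C} (hσ : ∀ c, ∃ b, σ b = some (1, c)) :
    Function.Injective (pull σ) := fun ψ ψ' h => by
  funext c
  obtain ⟨b, hb⟩ := hσ c
  simpa [pull, hb, ev] using congrFun h b

/-- An assignment satisfies the system `α i ≠ β i`, `i ∈ s`. -/
def Avoids (α β : ι → SignedPoint B) (s : Finset ι) (ψ : B → ℤ) : Prop :=
  ∀ i ∈ s, ev (α i) ψ ≠ ev (β i) ψ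

theorem avoids_subst (σ : B → SignedPoint C) (α β : ι → SignedPoint B) (s : Finset ι)
    (ψ : C → ℤ) : Avoids (fun i => subst σ (α i)) (fun i => subst σ (β i)) s ψ ↔
      Avoids α β s (pull σ ψ) := by
  simp only [Avoids, ev_subst]

theorem avoids_insert [DecidableEq ι] {α β : ι → SignedPoint B} {s : Finset ι} {i : ι}
    {ψ : B → ℤ} :
    Avoids α β (insert i s) ψ ↔ ev (α i) ψ ≠ ev (β i) ψ ∧ Avoids α β s ψ :=
  Finset.forall_mem_insert _ _ _

/-- Contraction, for the solutions that satisfy a further condition. -/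
noncomputable def elimEquiv {σ : B → SignedPoint C} {α β : SignedPoint B}
    (hσ : ∀ c, ∃ b, σ b = some (1, c)) (h : ∀ ψ, ev α ψ = ev β ψ ↔ ∃ ψ', pull σ ψ' = ψ)
    (P : (B → ℤ) → Prop) : {ψ' // P (pull σ ψ')} ≃ {ψ // P ψ ∧ ev α ψ = ev β ψ} :=
  Equiv.ofBijective (fun ψ' => ⟨pull σ ψ'.1, ψ'.2, (h _).2 ⟨_, rfl⟩⟩) <| by
    constructor
    · intro a b hab
      exact Subtype.ext (pull_injective hσ (Subtype.ext_iff.mp hab))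
    · rintro ⟨ψ, h1, h2⟩
      obtain ⟨ψ', rfl⟩ := (h ψ).1 h2
      exact ⟨⟨ψ', h1⟩, rfl⟩

/-! ### Counting solutions in a box, and regions -/

/-- The number of solutions of the system with all values in `{-k, …, k}`. -/
noncomputable def boxCount (α β : ι → SignedPoint B) (s : Finset ι) (k : ℕ) : ℕ :=
  Nat.card {ψ : B → ℤ // (∀ b, |ψ b| ≤ k) ∧ Avoids α β s ψ}

/-- The assignment `ψ` lies on the sides of the hyperplanes `α i = β i`, `i ∈ s`, that are
prescribed by `T`: it satisfies `α i > β i` if `i ∈ T` and `α i < β i` if `i ∉ T`. -/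
def Realizes (α β : ι → SignedPoint B) (s T : Finset ι) (ψ : B → ℤ) : Prop :=
  ∀ i ∈ s, (i ∈ T → ev (β i) ψ < ev (α i) ψ) ∧ (i ∉ T → ev (α i) ψ < ev (β i) ψ)

open Classical in
/-- The regions of the arrangement of the hyperplanes `α i = β i`, `i ∈ s`, each of them encoded by
the set of those `i ∈ s` for which `α i > β i` in the region. -/
noncomputable def regions (α β : ι → SignedPoint B) (s : Finset ι) : Finset (Finset ι) :=
  s.powerset.filter fun T => ∃ ψ, Realizes α β s T ψ

theorem finite_box [Finite B] (k : ℕ) (P : (B → ℤ) → Prop) :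
    Finite {ψ : B → ℤ // (∀ b, |ψ b| ≤ k) ∧ P ψ} := by
  refine Set.Finite.subset (Set.Finite.pi' fun _ : B => Set.finite_Icc (-(k : ℤ)) k) ?_
  intro ψ hψ b
  exact abs_le.1 (hψ.1 b)

theorem card_split {X : Type u} (P Q : X → Prop) [Finite {x // P x}] :
    Nat.card {x // P x} = Nat.card {x // Q x ∧ P x} + Nat.card {x // P x ∧ ¬ Q x} := by
  classical
  have h1 : Finite {x // Q x ∧ P x} := Finite.of_injective
    (fun x => (⟨x.1, x.2.2⟩ : {x // P x})) fun a b h => Subtype.ext (by simpa using h)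
  have h2 : Finite {x // P x ∧ ¬ Q x} := Finite.of_injective
    (fun x => (⟨x.1, x.2.1⟩ : {x // P x})) fun a b h => Subtype.ext (by simpa using h)
  rw [← Nat.card_sum]
  exact Nat.card_congr
    { toFun := fun x => if h : Q x.1 then .inl ⟨x.1, h, x.2⟩ else .inr ⟨x.1, x.2, h⟩
      invFun := Sum.elim (fun x => ⟨x.1, x.2.2⟩) fun x => ⟨x.1, x.2.1⟩
      left_inv := fun x => by
        by_cases h : Q x.1 <;> simp [h]
      right_inv := by
        rintro (⟨x, h⟩ | ⟨x, h⟩) <;> simp [h] }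

/-- Deletion and contraction for the number of solutions in a box. -/
theorem boxCount_insert [Finite B] [DecidableEq ι] {σ : B → SignedPoint C}
    {α β : ι → SignedPoint B} {i : ι} (hσ : ∀ c, ∃ b, σ b = some (1, c))
    (h : ∀ ψ, ev (α i) ψ = ev (β i) ψ ↔ ∃ ψ', pull σ ψ' = ψ) (s : Finset ι) (k : ℕ) :
    boxCount α β s k = boxCount α β (insert i s) k +
      boxCount (fun i => subst σ (α i)) (fun i => subst σ (β i)) s k := by
  have := finite_box (B := B) k (Avoids α β s)
  rw [boxCount, card_split _ fun ψ => ev (α i) ψ ≠ ev (β i) ψ]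
  congr 1
  · refine Nat.card_congr (Equiv.subtypeEquivRight fun ψ => ?_)
    rw [avoids_insert]
    tauto
  · symm
    refine Nat.card_congr ((Equiv.subtypeEquivRight fun ψ => ?_).trans
      ((elimEquiv hσ h fun ψ => (∀ b, |ψ b| ≤ k) ∧ Avoids α β s ψ).trans
        (Equiv.subtypeEquivRight fun ψ => by rw [not_not])))
    rw [avoids_subst]
    refine and_congr_left fun _ => ⟨fun hψ b => abs_ev_le _ (by positivity) hψ, fun hψ c => ?_⟩
    obtain ⟨b, hb⟩ := hσ c
    simpa [pull, hb, ev] using hψ b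

/-- A region of the smaller arrangement is cut by the new hyperplane if and only if it contains a
point of that hyperplane. -/
theorem cut_iff {α β : ι → SignedPoint B} {a b : SignedPoint B} (hab : a ≠ b) (s T : Finset ι) :
    ((∃ ψ, Realizes α β s T ψ ∧ ev a ψ < ev b ψ) ∧ ∃ ψ, Realizes α β s T ψ ∧ ev b ψ < ev a ψ) ↔
      ∃ ψ, Realizes α β s T ψ ∧ ev a ψ = ev b ψ := by
  classical
  constructor
  · rintro ⟨⟨ψ, h1, h2⟩, ψ', h1', h2'⟩
    -- a suitable convex combination, with denominators cleared
    refine ⟨fun x => (ev a ψ' - ev b ψ') * ψ x + (ev b ψ - ev a ψ) * ψ' x, ?_, ?_⟩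
    · intro i hi
      have hp : 0 < ev a ψ' - ev b ψ' := by linarith
      have hq : 0 < ev b ψ - ev a ψ := by linarith
      simp only [ev_comb]
      constructor <;> intro hT
      · nlinarith [(h1 i hi).1 hT, (h1' i hi).1 hT]
      · nlinarith [(h1 i hi).2 hT, (h1' i hi).2 hT]
    · simp only [ev_comb]
      ring
  · rintro ⟨ψ, h1, h2⟩
    -- move off the hyperplane by a relatively small multiple of `± δ`
    obtain ⟨x, γ, hγ⟩ := exists_solve hab
    obtain ⟨δ, hδ⟩ : ∃ δ : B → ℤ, ev a δ ≠ ev b δ := by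
      refine ⟨fun y => if y = x then 1 else 0, fun h => ?_⟩
      rw [hγ] at h
      rcases γ with _ | ⟨ε, y⟩
      · simp [ev] at h
      · simp [ev, y.2] at h
    have move : ∀ δ : B → ℤ, ∃ ψ', Realizes α β s T ψ' ∧ ev a ψ' - ev b ψ' = ev a δ - ev b δ := by
      intro δ
      set N : ℤ := 1 + ∑ i ∈ s, |ev (α i) δ - ev (β i) δ| with hN
      have hle : ∀ i ∈ s, |ev (α i) δ - ev (β i) δ| < N := fun i hi => by
        have := Finset.single_le_sum (f := fun i => |ev (α i) δ - ev (β i) δ|)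
          (fun _ _ => abs_nonneg _) hi
        linarith
      refine ⟨fun y => N * ψ y + 1 * δ y, fun i hi => ?_, ?_⟩
      · have hi' := abs_lt.1 (hle i hi)
        simp only [ev_comb]
        constructor <;> intro hT
        · nlinarith [(h1 i hi).1 hT]
        · nlinarith [(h1 i hi).2 hT]
      · simp only [ev_comb, h2]
        ring
    have neg : ∀ c : SignedPoint B, ev c (fun y => -δ y) = - ev c δ := fun c => by
      rcases c with _ | ⟨ε, y⟩ <;> simp [ev]
    obtain ⟨ψ₁, h3, h4⟩ := move δ
    obtain ⟨ψ₂, h5, h6⟩ := move fun y => -δ y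
    rw [neg, neg] at h6
    rcases lt_or_gt_of_ne hδ with h | h
    · exact ⟨⟨ψ₁, h3, by linarith⟩, ψ₂, h5, by linarith⟩
    · exact ⟨⟨ψ₂, h5, by linarith⟩, ψ₁, h3, by linarith⟩

theorem realizes_insert [DecidableEq ι] {α β : ι → SignedPoint B} {s T : Finset ι} {i : ι}
    (hi : i ∉ s) (hT : i ∉ T) (ψ : B → ℤ) :
    (Realizes α β (insert i s) T ψ ↔ Realizes α β s T ψ ∧ ev (α i) ψ < ev (β i) ψ) ∧
    (Realizes α β (insert i s) (insert i T) ψ ↔ Realizes α β s T ψ ∧ ev (β i) ψ < ev (α i) ψ) := by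
  have h : ∀ j ∈ s, (j ∈ insert i T ↔ j ∈ T) := fun j hj => by
    rw [Finset.mem_insert, or_iff_right]
    rintro rfl
    exact hi hj
  constructor
  · simp only [Realizes, Finset.forall_mem_insert]
    tauto
  · simp only [Realizes, Finset.forall_mem_insert]
    have h' : (∀ j ∈ s, (j ∈ insert i T → ev (β j) ψ < ev (α j) ψ) ∧
        (j ∉ insert i T → ev (α j) ψ < ev (β j) ψ)) ↔
        ∀ j ∈ s, (j ∈ T → ev (β j) ψ < ev (α j) ψ) ∧ (j ∉ T → ev (α j) ψ < ev (β j) ψ) :=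
      forall₂_congr fun j hj => by rw [h j hj]
    rw [h']
    have := Finset.mem_insert_self i T
    tauto

/-- Deletion and contraction for the number of regions. -/
theorem card_regions_insert [DecidableEq ι] {σ : B → SignedPoint C} {α β : ι → SignedPoint B}
    {i : ι} (hi : α i ≠ β i) (h : ∀ ψ, ev (α i) ψ = ev (β i) ψ ↔ ∃ ψ', pull σ ψ' = ψ)
    {s : Finset ι} (his : i ∉ s) :
    (regions α β (insert i s)).card = (regions α β s).card +
      (regions (fun i => subst σ (α i)) (fun i => subst σ (β i)) s).card := by
  classical
  have hmem : ∀ T ∈ s.powerset, i ∉ T := fun T hT hiT => his (Finset.mem_powerset.1 hT hiT)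
  have e1 : (regions α β (insert i s)).card =
      (s.powerset.filter fun T => ∃ ψ, Realizes α β s T ψ ∧ ev (α i) ψ < ev (β i) ψ).card +
      (s.powerset.filter fun T => ∃ ψ, Realizes α β s T ψ ∧ ev (β i) ψ < ev (α i) ψ).card := by
    rw [regions, Finset.powerset_insert, Finset.filter_union, Finset.card_union_of_disjoint]
    · congr 1
      · congr 1
        refine Finset.filter_congr fun T hT => ?_
        exact exists_congr fun ψ => (realizes_insert his (hmem T hT) ψ).1
      · rw [Finset.filter_image, Finset.card_image_of_injOn]
        · congr 1
          refine Finset.filter_congr fun T hT => ?_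
          exact exists_congr fun ψ => (realizes_insert his (hmem T hT) ψ).2
        · intro T hT T' hT' hTT
          have h1 := hmem T (Finset.mem_filter.1 hT).1
          have h2 := hmem T' (Finset.mem_filter.1 hT').1
          rw [← Finset.erase_insert h1, ← Finset.erase_insert h2, hTT]
    · rw [Finset.disjoint_left]
      intro T hT hT'
      obtain ⟨T', -, rfl⟩ := Finset.mem_image.1 (Finset.mem_filter.1 hT').1
      exact hmem _ (Finset.mem_filter.1 hT).1 (Finset.mem_insert_self _ _)
  rw [e1, ← Finset.card_union_add_card_inter, ← Finset.filter_or, ← Finset.filter_and]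
  congr 2
  · refine Finset.filter_congr fun T _ => ⟨?_, fun ⟨ψ, hψ⟩ => ?_⟩
    · rintro (⟨ψ, hψ, -⟩ | ⟨ψ, hψ, -⟩) <;> exact ⟨ψ, hψ⟩
    · rcases lt_trichotomy (ev (α i) ψ) (ev (β i) ψ) with h1 | h1 | h1
      · exact .inl ⟨ψ, hψ, h1⟩
      · exact .inl ((cut_iff hi s T).2 ⟨ψ, hψ, h1⟩).1
      · exact .inr ⟨ψ, hψ, h1⟩
  · refine Finset.filter_congr fun T _ => (cut_iff hi s T).trans ⟨?_, ?_⟩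
    · rintro ⟨ψ, h1, h2⟩
      obtain ⟨ψ', rfl⟩ := (h ψ).1 h2
      exact ⟨ψ', by simpa only [Realizes, ev_subst] using h1⟩
    · rintro ⟨ψ', h1⟩
      exact ⟨pull σ ψ', by simpa only [Realizes, ev_subst] using h1, (h _).2 ⟨ψ', rfl⟩⟩

/-- **Zaslavsky's theorem** for systems of signed equations: the number of solutions in
`{-k, …, k}` is a polynomial in `2 * k + 1`, whose value at `-1` counts the regions up to sign. -/
theorem exists_polynomial_boxCount (s : Finset ι) :
    ∀ (B : Type u) [Fintype B] (α β : ι → SignedPoint B), ∃ Q : Polynomial ℚ,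
      (∀ k : ℕ, Q.eval (2 * k + 1 : ℚ) = boxCount α β s k) ∧
        Q.eval (-1) = (-1) ^ Fintype.card B * (regions α β s).card := by
  classical
  induction s using Finset.induction_on with
  | empty =>
    intro B _ α β
    refine ⟨Polynomial.X ^ Fintype.card B, fun k => ?_, ?_⟩
    · have e : {ψ : B → ℤ // (∀ b, |ψ b| ≤ k) ∧ Avoids α β ∅ ψ} ≃
          (B → {i // i ∈ Finset.Icc (-(k : ℤ)) k}) :=
        (Equiv.subtypeEquivRight fun ψ => by simp [Avoids, abs_le]).trans
          Equiv.subtypePiEquivPi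
      rw [boxCount, Nat.card_congr e, Nat.card_fun]
      simp only [Polynomial.eval_pow, Polynomial.eval_X, Nat.card_eq_fintype_card,
        Fintype.card_coe, Int.card_Icc]
      have : ((k : ℤ) + 1 - -k).toNat = 2 * k + 1 := by omega
      rw [this]
      push_cast
      rfl
    · have : regions α β ∅ = {∅} := by
        ext T
        simp only [regions, Finset.powerset_empty, Finset.mem_filter, Finset.mem_singleton,
          and_iff_left_iff_imp]
        exact fun _ => ⟨0, by simp [Realizes]⟩
      simp [this]
  | insert i s his ih =>
    intro B _ α β
    by_cases hi : α i = β i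
    · refine ⟨0, fun k => ?_, ?_⟩
      · have : IsEmpty {ψ : B → ℤ // (∀ b, |ψ b| ≤ k) ∧ Avoids α β (insert i s) ψ} :=
          ⟨fun ψ => ψ.2.2 i (Finset.mem_insert_self _ _) (by rw [hi])⟩
        simp [boxCount]
      · have : regions α β (insert i s) = ∅ := by
          refine Finset.filter_eq_empty_iff.2 fun T _ => ?_
          rintro ⟨ψ, hψ⟩
          have := hψ i (Finset.mem_insert_self _ _)
          rw [hi] at this
          by_cases hT : i ∈ T
          · exact lt_irrefl _ (this.1 hT)
          · exact lt_irrefl _ (this.2 hT)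
        simp [this]
    · obtain ⟨C, _, σ, hcard, hσ, h⟩ := exists_elim hi
      obtain ⟨Q, hQ, hQ'⟩ := ih B α β
      obtain ⟨R, hR, hR'⟩ := ih C (fun i => subst σ (α i)) (fun i => subst σ (β i))
      refine ⟨Q - R, fun k => ?_, ?_⟩
      · rw [Polynomial.eval_sub, hQ, hR, boxCount_insert hσ h]
        push_cast
        ring
      · rw [Polynomial.eval_sub, hQ', hR', card_regions_insert hi h his, hcard]
        push_cast
        ring

end SignedPoint

namespace SignedPoint

open BSymmetric

variable {ι : Type v} {B C : Type u} {W : Type w} [Fintype W]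

/-! ### Generating functions of systems lie in the basis algebra -/

/-- The monomial of the coloring of `W` that takes the value `ev (L x) ψ` at `x`. -/
noncomputable def colorMonomial (L : W → SignedPoint B) (ψ : B → ℤ) : ℤ →₀ ℕ :=
  ∑ x, Finsupp.single (ev (L x) ψ) 1

theorem colorMonomial_subst (σ : B → SignedPoint C) (L : W → SignedPoint B) (ψ : C → ℤ) :
    colorMonomial (fun x => subst σ (L x)) ψ = colorMonomial L (pull σ ψ) := by
  simp only [colorMonomial, ev_subst]

/-- The monomial of a coloring, with the equal or opposite values collected. -/
theorem colorMonomial_eq [Fintype B] (L : W → SignedPoint B) :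
    ∃ (c : ℕ) (m n : B → ℕ), (∀ b, (∃ x, L x = some (1, b)) → 1 ≤ m b) ∧
      ∀ ψ, colorMonomial L ψ = Finsupp.single 0 c +
        ∑ b, (Finsupp.single (ψ b) (m b) + Finsupp.single (-ψ b) (n b)) := by
  classical
  let N : SignedPoint B → ℕ := fun α => (Finset.univ.filter fun x => L x = α).card
  refine ⟨N none, fun b => N (some (1, b)), fun b => N (some (-1, b)), ?_, fun ψ => ?_⟩
  · rintro b ⟨x, hx⟩
    exact Finset.card_pos.2 ⟨x, by simp [hx]⟩
  · have h1 : colorMonomial L ψ = ∑ α, N α • Finsupp.single (ev α ψ) 1 := by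
      rw [colorMonomial, ← Finset.sum_fiberwise Finset.univ L]
      refine Finset.sum_congr rfl fun α _ => ?_
      rw [Finset.sum_congr rfl (g := fun _ => Finsupp.single (ev α ψ) 1), Finset.sum_const]
      intro x hx
      rw [(Finset.mem_filter.1 hx).2]
    have h2 : (Finset.univ : Finset ℤˣ) = {1, -1} := by decide
    rw [h1, Fintype.sum_option, Fintype.sum_prod_type_right]
    simp [h2, ev]

theorem finiteFibers_colorMonomial [Fintype B] {L : W → SignedPoint B}
    (hL : ∀ b, ∃ x, L x = some (1, b)) :
    FiniteFibers (colorMonomial L) ∧ monomialSum (colorMonomial L) ∈ basisAlgebra := by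
  obtain ⟨c, m, n, hm, h⟩ := colorMonomial_eq L
  have hm' : ∀ b, 1 ≤ m b := fun b => hm b (hL b)
  obtain ⟨h1, h2⟩ := monomialSum_pi B
    (fun b i => Finsupp.single i (m b) + Finsupp.single (-i) (n b))
    fun b => finiteFibers_p _ _ (hm' b)
  have h0 : FiniteFibers fun _ : Unit => Finsupp.single (0 : ℤ) c := fun _ => inferInstance
  constructor
  · have := (h0.prod h1).comp (Equiv.punitProd (B → ℤ)).symm.injective
    convert this using 2 with ψ
    exact h ψ
  · rw [← monomialSum_equiv (Equiv.punitProd (B → ℤ)) (f := fun x : Unit × (B → ℤ) =>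
      Finsupp.single 0 c + ∑ b, (Finsupp.single (x.2 b) (m b) + Finsupp.single (-x.2 b) (n b)))
      fun x => h x.2, ← monomialSum_mul h0 h1, ← h2, monomialSum_unit]
    refine mul_mem ?_ (prod_mem fun b _ => p_mem _ _ (by have := hm' b; omega))
    rw [← MvPowerSeries.X_pow_eq]
    exact pow_mem X_zero_mem _

/-- The generating function of the solutions of a system is a polynomial in the augmented
elementary `B`-symmetric basis, by deletion and contraction. -/
theorem generatingFunction_mem (s : Finset ι) :
    ∀ (B : Type u) [Fintype B] (α β : ι → SignedPoint B) (L : W → SignedPoint B),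
      (∀ b, ∃ x, L x = some (1, b)) →
        monomialSum (fun ψ : {ψ // Avoids α β s ψ} => colorMonomial L ψ.1) ∈ basisAlgebra := by
  classical
  induction s using Finset.induction_on with
  | empty =>
    intro B _ α β L hL
    rw [monomialSum_equiv (f := fun ψ : {ψ // Avoids α β ∅ ψ} => colorMonomial L ψ.1)
      (Equiv.subtypeUnivEquiv (p := Avoids α β ∅) fun ψ => by simp [Avoids])
      (g := colorMonomial L) fun _ => rfl]
    exact (finiteFibers_colorMonomial hL).2
  | insert i s his ih =>
    intro B _ α β L hL
    by_cases hi : α i = β i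
    · have : IsEmpty {ψ // Avoids α β (insert i s) ψ} :=
        ⟨fun ψ => ψ.2 i (Finset.mem_insert_self _ _) (by rw [hi])⟩
      have h0 : monomialSum (fun ψ : {ψ // Avoids α β (insert i s) ψ} => colorMonomial L ψ.1) = 0 := by
        funext m
        simp [monomialSum]
        rfl
      rw [h0]
      exact zero_mem _
    · obtain ⟨C, _, σ, hcard, hσ, h⟩ := exists_elim hi
      have hF := (finiteFibers_colorMonomial hL).1.comp
        (Subtype.val_injective (p := Avoids α β s))
      have h1 := ih B α β L hL
      have h2 := ih C (fun i => subst σ (α i)) (fun i => subst σ (β i)) (fun x => subst σ (L x))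
        fun c => by
          obtain ⟨b, hb⟩ := hσ c
          obtain ⟨x, hx⟩ := hL b
          exact ⟨x, by simp [hx, subst, hb]⟩
      have h3 := monomialSum_split hF fun ψ => ev (α i) ψ.1 = ev (β i) ψ.1
      have e1 : monomialSum (fun ψ : {ψ : {ψ // Avoids α β s ψ} // ev (α i) ψ.1 = ev (β i) ψ.1} =>
            colorMonomial L ψ.1.1) =
          monomialSum fun ψ : {ψ // Avoids (fun i => subst σ (α i)) (fun i => subst σ (β i)) s ψ} =>
            colorMonomial (fun x => subst σ (L x)) ψ.1 :=
        (monomialSum_equiv ((Equiv.subtypeEquivRight fun ψ => avoids_subst σ α β s ψ).trans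
          ((elimEquiv hσ h (Avoids α β s)).trans
            (Equiv.subtypeSubtypeEquivSubtypeInter (Avoids α β s)
              fun ψ => ev (α i) ψ = ev (β i) ψ).symm))
          fun ψ => (colorMonomial_subst σ L ψ.1).symm).symm
      have e2 : monomialSum (fun ψ : {ψ : {ψ // Avoids α β s ψ} // ¬ ev (α i) ψ.1 = ev (β i) ψ.1} =>
            colorMonomial L ψ.1.1) =
          monomialSum fun ψ : {ψ // Avoids α β (insert i s) ψ} => colorMonomial L ψ.1 :=
        monomialSum_equiv ((Equiv.subtypeSubtypeEquivSubtypeInter (Avoids α β s)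
          fun ψ => ¬ ev (α i) ψ = ev (β i) ψ).trans
            (Equiv.subtypeEquivRight fun ψ => by rw [avoids_insert, and_comm])) fun ψ => rfl
      rw [← e2, ← sub_eq_of_eq_add' h3]
      refine sub_mem h1 ?_
      rw [e1]
      exact h2

end SignedPoint

namespace SignedGraph

open SignedPoint

variable {V : Type u} {E : Type v} (G : SignedGraph V E)

theorem isProper_iff (κ : V → ℤ) :
    G.IsProper κ ↔ ∀ e, κ (G.ends e false) ≠ (G.sgn e : ℤ) * κ (G.ends e true) := by
  constructor
  · exact fun h e => h e _ _ ⟨false, rfl, rfl⟩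
  · rintro h e _ _ ⟨b, rfl, rfl⟩
    have := h e
    rcases Int.units_eq_one_or (G.sgn e) with hs | hs <;> rw [hs] at this ⊢ <;> cases b <;>
      simp at this ⊢ <;> omega

theorem chromaticB_mem [Fintype V] [Finite E] : G.chromaticB ∈ BSymmetric.basisAlgebra := by
  classical
  have := Fintype.ofFinite E
  have h := generatingFunction_mem Finset.univ V (fun e => some (1, G.ends e false))
    (fun e => some (G.sgn e, G.ends e true)) (fun x : V => some (1, x)) fun b => ⟨b, rfl⟩
  convert h using 1
  refine BSymmetric.monomialSum_equiv (Equiv.subtypeEquivRight fun κ => ?_) fun κ => ?_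
  · rw [isProper_iff]
    simp [Avoids, ev]
  · simp [colorMonomial, ev]

end SignedGraph

namespace BSymmetric

/-! ### Evaluation at finitely many variables -/

/-- The power series obtained from `f` by setting the variables outside `S` to `0`. -/
noncomputable def restrictFun (S : Finset ℤ) (f : MvPowerSeries ℤ ℚ) : MvPowerSeries ℤ ℚ :=
  fun m => if m.support ⊆ S then f m else 0

theorem coeff_restrictFun (S : Finset ℤ) (f : MvPowerSeries ℤ ℚ) (m : ℤ →₀ ℕ) :
    MvPowerSeries.coeff m (restrictFun S f) =
      if m.support ⊆ S then MvPowerSeries.coeff m f else 0 := rfl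

/-- Setting the variables outside `S` to `0`, as a homomorphism. -/
noncomputable def restrictVars (S : Finset ℤ) : MvPowerSeries ℤ ℚ →+* MvPowerSeries ℤ ℚ where
  toFun := restrictFun S
  map_one' := by
    classical
    ext m
    rw [coeff_restrictFun, MvPowerSeries.coeff_one]
    by_cases h : m = 0 <;> simp [h]
  map_zero' := by
    ext m
    simp [coeff_restrictFun]
  map_add' f g := by
    ext m
    simp only [coeff_restrictFun, map_add]
    split_ifs <;> simp
  map_mul' f g := by
    classical
    ext m
    simp only [coeff_restrictFun, MvPowerSeries.coeff_mul]
    have hs : ∀ d ∈ Finset.HasAntidiagonal.antidiagonal m,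
        (m.support ⊆ S ↔ d.1.support ⊆ S ∧ d.2.support ⊆ S) := fun d hd => by
      rw [← Finset.HasAntidiagonal.mem_antidiagonal.1 hd, ← Finset.union_subset_iff]
      have : (d.1 + d.2).support = d.1.support ∪ d.2.support := by
        ext i
        simp only [Finsupp.mem_support_iff, Finsupp.add_apply, Finset.mem_union]
        omega
      rw [this]
    split_ifs with h
    · refine Finset.sum_congr rfl fun d hd => ?_
      rw [if_pos ((hs d hd).1 h).1, if_pos ((hs d hd).1 h).2]
    · refine (Finset.sum_eq_zero fun d hd => ?_).symm
      by_cases h1 : d.1.support ⊆ S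
      · rw [if_neg fun h2 => h ((hs d hd).2 ⟨h1, h2⟩), mul_zero]
      · rw [if_neg h1, zero_mul]

/-- After the variables outside `S` are set to `0`, the series `f` becomes a polynomial, whose value
at the point `x` is `c`. -/
def HasValue (S : Finset ℤ) (x : ℤ → ℚ) (f : MvPowerSeries ℤ ℚ) (c : ℚ) : Prop :=
  ∃ Q : MvPolynomial ℤ ℚ, restrictVars S f = Q ∧ MvPolynomial.eval x Q = c

namespace HasValue

variable {S : Finset ℤ} {x : ℤ → ℚ} {f : MvPowerSeries ℤ ℚ} {c d : ℚ}

theorem unique (h : HasValue S x f c) (h' : HasValue S x f d) : c = d := by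
  obtain ⟨P, hP, rfl⟩ := h
  obtain ⟨Q, hQ, rfl⟩ := h'
  rw [MvPolynomial.coe_injective ℤ ℚ (hP.symm.trans hQ)]

theorem neg (h : HasValue S x f c) : HasValue S x (-f) (-c) := by
  obtain ⟨P, hP, rfl⟩ := h
  refine ⟨-P, ?_, by simp⟩
  rw [map_neg, hP]
  exact (map_neg MvPolynomial.coeToMvPowerSeries.ringHom P).symm

theorem neg_one_pow_mul (n : ℕ) (h : HasValue S x f c) :
    HasValue S x ((-1) ^ n * f) ((-1) ^ n * c) := by
  rcases n.even_or_odd with hn | hn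
  · simpa [hn.neg_one_pow] using h
  · simpa [hn.neg_one_pow] using h.neg

theorem monomialSum {ι : Type u} (f : ι → (ℤ →₀ ℕ)) (T : Finset ι)
    (hT : ∀ i, i ∈ T ↔ (f i).support ⊆ S) :
    HasValue S x (monomialSum f) (∑ i ∈ T, (f i).prod fun j n => x j ^ n) := by
  classical
  refine ⟨∑ i ∈ T, MvPolynomial.monomial (f i) 1, ?_, by simp [MvPolynomial.eval_monomial]⟩
  ext m
  rw [MvPolynomial.coeff_coe, MvPolynomial.coeff_sum]
  change (if m.support ⊆ S then (Nat.card {i // f i = m} : ℚ) else 0) = _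
  simp only [MvPolynomial.coeff_monomial]
  rw [Finset.sum_boole]
  split_ifs with h
  · congr 1
    refine Nat.subtype_card _ fun i => ?_
    rw [Finset.mem_filter, hT, and_iff_right_iff_imp]
    rintro rfl
    exact h
  · rw [Finset.filter_eq_empty_iff.2]
    · simp
    · intro i hi him
      exact h (him ▸ (hT i).1 hi)

theorem aeval {fam : Gen → MvPowerSeries ℤ ℚ} {v : Gen → ℚ} (h : ∀ g, HasValue S x (fam g) (v g))
    (F : MvPolynomial Gen ℚ) :
    HasValue S x (MvPolynomial.aeval fam F) (MvPolynomial.eval v F) := by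
  choose P hP hv using h
  refine ⟨MvPolynomial.aeval P F, ?_, ?_⟩
  · have : (restrictVars S).comp (MvPolynomial.aeval fam : MvPolynomial Gen ℚ →ₐ[ℚ] _).toRingHom =
        MvPolynomial.coeToMvPowerSeries.ringHom.comp
          (MvPolynomial.aeval P : MvPolynomial Gen ℚ →ₐ[ℚ] _).toRingHom := by
      refine MvPolynomial.ringHom_ext (fun r => ?_) fun g => by simp [hP]
      exact RingHom.congr_fun (RingHom.ext_rat (((restrictVars S).comp
        (MvPolynomial.aeval fam : MvPolynomial Gen ℚ →ₐ[ℚ] _).toRingHom).comp MvPolynomial.C)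
        ((MvPolynomial.coeToMvPowerSeries.ringHom.comp
          (MvPolynomial.aeval P : MvPolynomial Gen ℚ →ₐ[ℚ] _).toRingHom).comp MvPolynomial.C)) r
    exact RingHom.congr_fun this F
  · have : (MvPolynomial.eval x).comp (MvPolynomial.aeval P : MvPolynomial Gen ℚ →ₐ[ℚ] _).toRingHom =
        MvPolynomial.eval v :=
      MvPolynomial.ringHom_ext (fun r => by simp) fun g => by simp [hv]
    exact RingHom.congr_fun this F

theorem p {a b : ℕ} (ha : 1 ≤ a) (T : Finset ℤ)
    (hT : ∀ i, i ∈ T ↔ i ∈ S ∧ (1 ≤ b → -i ∈ S)) :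
    HasValue S x (p a b) (∑ i ∈ T, x i ^ a * x (-i) ^ b) := by
  classical
  have h := HasValue.monomialSum (S := S) (x := x)
    (fun i => Finsupp.single i a + Finsupp.single (-i) b) T fun i => ?_
  · refine Eq.subst (motive := HasValue S x _) (Finset.sum_congr rfl fun i hi => ?_) h
    rw [Finsupp.prod_add_index' (by simp) (by simp [pow_add])]
    simp
  · have : (Finsupp.single i a + Finsupp.single (-i) b).support =
        {i} ∪ (Finsupp.single (-i) b).support := by
      ext j
      simp only [Finsupp.mem_support_iff, Finsupp.add_apply, Finset.mem_union,
        Finset.mem_singleton]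
      by_cases hj : i = j
      · subst hj
        simp
        omega
      · simp [Finsupp.single_apply, Ne.symm hj]
    rw [hT, this, Finset.union_subset_iff, Finset.singleton_subset_iff]
    rcases b with _ | b
    · simp
    · rw [Finsupp.support_single _ (by omega)]
      simp

theorem e (n : ℕ) : HasValue S x (e n) (∑ s ∈ S.powersetCard n, ∏ i ∈ s, x i) := by
  classical
  have hsupp : ∀ s : Finset ℤ, (∑ i ∈ s, Finsupp.single i 1 : ℤ →₀ ℕ).support = s := fun s => by
    ext j
    simp [Finsupp.finsetSum_apply, Finsupp.single_apply]
  have h := HasValue.monomialSum (S := S) (x := x)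
    (fun s : {s : Finset ℤ // s.card = n} => ∑ i ∈ s.1, Finsupp.single i 1)
    ((S.powersetCard n).subtype fun s => s.card = n) fun s => by
      rw [hsupp, Finset.mem_subtype, Finset.mem_powersetCard, and_iff_left s.2]
  refine Eq.subst (motive := HasValue S x _) (Eq.symm ?_) h
  rw [← Finset.sum_subtype_of_mem (p := fun s : Finset ℤ => s.card = n)
    (fun s : Finset ℤ => ∏ i ∈ s, x i) fun s hs => (Finset.mem_powersetCard.1 hs).2]
  refine Finset.sum_congr rfl fun s _ => ?_
  rw [← Finsupp.prod_finsetSum_index (by simp) (by simp [pow_add])]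
  simp

theorem z (h : (0 : ℤ) ∈ S) : HasValue S x z (-x 0) := by
  classical
  refine HasValue.neg ⟨MvPolynomial.X 0, ?_, by simp⟩
  ext m
  rw [MvPolynomial.coe_X]
  change (if m.support ⊆ S then MvPowerSeries.coeff m (MvPowerSeries.X (0 : ℤ)) else 0) = _
  rw [MvPowerSeries.coeff_X]
  by_cases hm : m = Finsupp.single 0 1
  · rw [if_pos]
    rw [hm, Finsupp.support_single _ one_ne_zero]
    simpa using h
  · simp [hm]

end HasValue

end BSymmetric

namespace BSymmetric

/-! ### Newton's recursion -/

section Newton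

variable {R : Type u} [CommRing R] [Algebra ℚ R]

/-- The elementary functions as polynomials in the power sums, by Newton's recursion; `P i` stands
for the power sum of degree `i + 1`. -/
noncomputable def newtonE (P : ℕ → R) : ℕ → R
  | 0 => 1
  | n + 1 => (1 / ((n + 1 : ℕ) : ℚ)) • ∑ i : Fin (n + 1), (-1) ^ (i : ℕ) * newtonE P (n - i) * P i

/-- The power sums as polynomials in the elementary functions; `newtonP f i` stands for the power
sum of degree `i + 1`. -/
noncomputable def newtonP (f : ℕ → R) (n : ℕ) : R :=
  (-1) ^ n * (((n + 1 : ℕ) : ℚ) • f (n + 1) -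
    ∑ i : Fin n, (-1) ^ (i : ℕ) * f (n - i) * newtonP f i)

theorem eq_newtonE {f P : ℕ → R} (h0 : f 0 = 1)
    (h : ∀ n, ((n + 1 : ℕ) : ℚ) • f (n + 1) =
      ∑ i ∈ Finset.range (n + 1), (-1) ^ i * f (n - i) * P i) (n : ℕ) : f n = newtonE P n := by
  induction n using Nat.strong_induction_on with
  | _ n ih =>
    rcases n with _ | n
    · rw [h0, newtonE]
    · have h1 : ∑ i ∈ Finset.range (n + 1), (-1) ^ i * newtonE P (n - i) * P i =
          ∑ i ∈ Finset.range (n + 1), (-1) ^ i * f (n - i) * P i :=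
        Finset.sum_congr rfl fun i _ => by rw [ih (n - i) (by omega)]
      rw [newtonE, Fin.sum_univ_eq_sum_range (fun i => (-1) ^ i * newtonE P (n - i) * P i), h1,
        ← h n, smul_smul,
        one_div_mul_cancel (by positivity), one_smul]

theorem newtonE_succ (P : ℕ → R) (n : ℕ) : ((n + 1 : ℕ) : ℚ) • newtonE P (n + 1) =
    ∑ i ∈ Finset.range (n + 1), (-1) ^ i * newtonE P (n - i) * P i := by
  rw [newtonE, Fin.sum_univ_eq_sum_range (fun i => (-1) ^ i * newtonE P (n - i) * P i), smul_smul,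
    mul_one_div_cancel (by positivity), one_smul]

theorem newtonE_newtonP {f : ℕ → R} (h0 : f 0 = 1) (n : ℕ) : newtonE (newtonP f) n = f n := by
  refine (eq_newtonE h0 (fun n => ?_) n).symm
  rw [Finset.sum_range_succ, newtonP, Fin.sum_univ_eq_sum_range
    (fun i => (-1) ^ i * f (n - i) * newtonP f i), Nat.sub_self, h0, mul_one, ← mul_assoc,
    ← mul_pow]
  simp

theorem map_newtonE {R' : Type v} [CommRing R'] [Algebra ℚ R'] (φ : R →ₐ[ℚ] R') (P : ℕ → R)
    (n : ℕ) : φ (newtonE P n) = newtonE (fun i => φ (P i)) n := by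
  refine eq_newtonE (f := fun n => φ (newtonE P n)) (by simp [newtonE]) (fun n => ?_) n
  rw [← map_smul, newtonE_succ]
  simp

end Newton

/-! ### Algebraic independence of the power sums -/

/-- The basis obtained from the augmented elementary basis by replacing `e_n` with `p_{n,0}`. -/
noncomputable def powerFamily : Gen → MvPowerSeries ℤ ℚ
  | .e n _ => p n 0
  | .q a b _ _ => q a b
  | .z => z

/-- The degrees of the two variables in the power sum attached to an element of the basis. -/
def Gen.degrees : Gen → ℕ × ℕ
  | .e n _ => (n, 0)
  | .q a b _ _ => (a, b)
  | .z => (0, 0)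

/-- The sign with which the power sum occurs in `powerFamily`; it is `0` for `z`. -/
def Gen.sign : Gen → ℚ
  | .e _ _ => 1
  | .q a b _ _ => (-1) ^ (a + b + 1)
  | .z => 0

/-- What a pair of variables `x_i = x`, `x_{-i} = y` with `i ≥ 1` contributes to `powerFamily`. -/
def pairVec (T : ℚ × ℚ) (g : Gen) : ℚ :=
  g.sign * (T.1 ^ g.degrees.1 * T.2 ^ g.degrees.2 + T.2 ^ g.degrees.1 * T.1 ^ g.degrees.2)

/-- What the variable `x_0 = c` contributes to `powerFamily`. -/
def baseVec (c : ℚ) : Gen → ℚ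
  | .z => -c
  | g => g.sign * (c ^ g.degrees.1 * c ^ g.degrees.2)

theorem sum_Icc_neg (f : ℤ → ℚ) (N : ℕ) : ∑ i ∈ Finset.Icc (-(N : ℤ)) N, f i =
    f 0 + ∑ i ∈ Finset.range N, (f (i + 1) + f (-(i + 1))) := by
  induction N with
  | zero => simp
  | succ N ih =>
    have h : Finset.Icc (-((N + 1 : ℕ) : ℤ)) ((N + 1 : ℕ) : ℤ) =
        insert ((N : ℤ) + 1) (insert (-((N : ℤ) + 1)) (Finset.Icc (-(N : ℤ)) N)) := by
      ext i
      simp only [Finset.mem_Icc, Finset.mem_insert]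
      push_cast
      omega
    rw [h, Finset.sum_insert, Finset.sum_insert, ih, Finset.sum_range_succ]
    · ring
    · simp only [Finset.mem_Icc]
      omega
    · simp only [Finset.mem_Icc, Finset.mem_insert]
      omega

/-- The values of `powerFamily` at the points with finitely many nonzero coordinates. -/
theorem hasValue_powerFamily (c : ℚ) (T : ℕ → ℚ × ℚ) (N : ℕ) :
    ∃ (S : Finset ℤ) (x : ℤ → ℚ), ∀ g,
      HasValue S x (powerFamily g) ((baseVec c + ∑ i ∈ Finset.range N, pairVec (T i)) g) := by
  let x : ℤ → ℚ := fun j =>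
    if 0 < j then (T (j - 1).toNat).1 else if j < 0 then (T (-j - 1).toNat).2 else c
  have x0 : x 0 = c := by simp [x]
  have x1 : ∀ i : ℕ, x (i + 1) = (T i).1 := fun i => by
    have h : (0 : ℤ) < i + 1 := by omega
    simp [x, h]
  have x2 : ∀ i : ℕ, x (-(i + 1)) = (T i).2 := fun i => by
    have h : ¬ (0 : ℤ) < -(i + 1) := by omega
    have h' : -(i + 1) < (0 : ℤ) := by omega
    simp only [x, if_neg h, if_pos h']
    simp
  have hp : ∀ a b, 1 ≤ a → HasValue (Finset.Icc (-(N : ℤ)) N) x (p a b) (c ^ a * c ^ b +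
      ∑ i ∈ Finset.range N, ((T i).1 ^ a * (T i).2 ^ b + (T i).2 ^ a * (T i).1 ^ b)) := by
    intro a b ha
    refine Eq.subst (motive := HasValue _ x _) ?_
      (HasValue.p ha (Finset.Icc (-(N : ℤ)) N) fun i => ?_)
    · rw [sum_Icc_neg]
      simp only [neg_neg, neg_zero, x0, x1, x2]
    · simp only [Finset.mem_Icc]
      omega
  refine ⟨Finset.Icc (-(N : ℤ)) N, x, fun g => ?_⟩
  rw [Pi.add_apply, Finset.sum_apply]
  rcases g with ⟨n, hn⟩ | ⟨a, b, hb, hab⟩ | _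
  · simpa [powerFamily, baseVec, pairVec, Gen.sign, Gen.degrees] using hp n 0 hn
  · have h := (hp a b (by omega)).neg_one_pow_mul (a + b + 1)
    rw [mul_add, Finset.mul_sum] at h
    exact h
  · have h := HasValue.z (S := Finset.Icc (-(N : ℤ)) N) (x := x) (by simp)
    simpa [powerFamily, baseVec, pairVec, Gen.sign, x0] using h

theorem exists_sum_pairVec {u : Gen → ℚ} (hu : u ∈ AddSubmonoid.closure (Set.range pairVec)) :
    ∃ (N : ℕ) (T : ℕ → ℚ × ℚ), u = ∑ i ∈ Finset.range N, pairVec (T i) := by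
  induction hu using AddSubmonoid.closure_induction_left with
  | zero => exact ⟨0, fun _ => 0, by simp⟩
  | add_left v hv u _ ih =>
    obtain ⟨t, rfl⟩ := hv
    obtain ⟨N, T, rfl⟩ := ih
    refine ⟨N + 1, fun i => Nat.casesOn i t T, ?_⟩
    rw [Finset.sum_range_succ', add_comm]
    rfl

theorem polynomial_eq_zero_of_nat {Q : Polynomial ℚ} (h : ∀ n : ℕ, Q.eval (n : ℚ) = 0) : Q = 0 :=
  Q.eq_zero_of_infinite_isRoot
    (Set.infinite_of_injective_forall_mem (Nat.cast_injective (R := ℚ)) h)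

/-- A polynomial that vanishes on the translate of an additive monoid vanishes on the translate of
the vector space that the monoid spans: restricted to a line in the direction of a generator, it is
a polynomial with infinitely many zeros. -/
theorem eval_eq_zero_of_mem_span {J : Type u} {A : Set (J → ℚ)} {H : MvPolynomial J ℚ} {h : J → ℚ}
    (hh : h ∈ Submodule.span ℚ A) :
    ∀ v, (∀ u ∈ AddSubmonoid.closure A, MvPolynomial.eval (v + u) H = 0) →
      ∀ u ∈ AddSubmonoid.closure A, MvPolynomial.eval (v + h + u) H = 0 := by
  induction hh using Submodule.closure_induction with
  | zero => simp
  | add x y _ _ hx hy =>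
    intro v hv
    rw [← add_assoc]
    exact hy _ (hx _ hv)
  | smul_mem r g hg =>
    intro v hv u hu
    let Q : Polynomial ℚ := MvPolynomial.aeval
      (fun j => Polynomial.C (v j + u j) + Polynomial.X * Polynomial.C (g j)) H
    have hQ : ∀ r : ℚ, Q.eval r = MvPolynomial.eval (v + r • g + u) H := by
      intro r
      have : (Polynomial.evalRingHom r).comp (MvPolynomial.aeval
          (fun j => Polynomial.C (v j + u j) + Polynomial.X * Polynomial.C (g j)) :
            MvPolynomial J ℚ →ₐ[ℚ] _).toRingHom = MvPolynomial.eval (v + r • g + u) := by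
        refine MvPolynomial.ringHom_ext (fun a => by simp) fun j => ?_
        simp
        ring
      exact RingHom.congr_fun this H
    have h0 : Q = 0 := polynomial_eq_zero_of_nat fun n => by
      rw [hQ, add_assoc]
      refine hv _ (add_mem ?_ hu)
      rw [Nat.cast_smul_eq_nsmul]
      exact nsmul_mem (AddSubmonoid.subset_closure hg) n
    rw [← hQ, h0, Polynomial.eval_zero]

theorem Gen.degrees_le (g : Gen) : g.degrees.2 ≤ g.degrees.1 := by
  cases g <;> simp [Gen.degrees, *]

theorem Gen.degrees_injective : Function.Injective Gen.degrees := by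
  intro g g' h
  rcases g with ⟨n, hn⟩ | ⟨a, b, hb, hab⟩ | _ <;> rcases g' with ⟨n', hn'⟩ | ⟨a', b', hb', hab'⟩ | _ <;>
    simp only [Gen.degrees, Prod.mk.injEq] at h <;> first | omega | (obtain ⟨rfl, _⟩ := h; first | rfl | (subst_vars; rfl))

theorem Gen.sign_ne_zero {g : Gen} (hg : g ≠ .z) : g.sign ≠ 0 := by
  cases g <;> simp_all [Gen.sign]

/-- The functions `T ↦ pairVec T g`, `g ≠ z`, are linearly independent: their monomials are
distinct. -/
theorem coeff_eq_zero_of_sum_pairVec {J : Finset Gen} {c : J → ℚ}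
    (h : ∀ T, ∑ j : J, pairVec T j.1 * c j = 0) (j : J) (hj : j.1 ≠ .z) : c j = 0 := by
  classical
  let m : ℕ → ℕ → (Bool →₀ ℕ) := fun a b => Finsupp.single false a + Finsupp.single true b
  have hm : ∀ a b a' b', m a b = m a' b' ↔ a = a' ∧ b = b' := fun a b a' b' => by
    constructor
    · intro h
      exact ⟨by simpa [m] using DFunLike.congr_fun h false,
        by simpa [m] using DFunLike.congr_fun h true⟩
    · rintro ⟨rfl, rfl⟩
      rfl
  let Q : MvPolynomial Bool ℚ := ∑ j : J, MvPolynomial.C (c j * j.1.sign) *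
    (MvPolynomial.monomial (m j.1.degrees.1 j.1.degrees.2) 1 +
      MvPolynomial.monomial (m j.1.degrees.2 j.1.degrees.1) 1)
  have hev : ∀ (x : Bool → ℚ) a b, MvPolynomial.eval x (MvPolynomial.monomial (m a b) 1) =
      x false ^ a * x true ^ b := fun x a b => by
    rw [MvPolynomial.eval_monomial, Finsupp.prod_add_index' (by simp) (by simp [pow_add])]
    simp
  have hQ : Q = 0 := by
    refine MvPolynomial.funext fun x => ?_
    rw [map_zero, map_sum, ← h (x false, x true)]
    refine Finset.sum_congr rfl fun j _ => ?_
    rw [map_mul, MvPolynomial.eval_C, map_add, hev, hev, pairVec]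
    ring
  have hc : MvPolynomial.coeff (m j.1.degrees.1 j.1.degrees.2) Q = 0 := by
    rw [hQ, MvPolynomial.coeff_zero]
  rw [MvPolynomial.coeff_sum, Finset.sum_eq_single j] at hc
  · rw [MvPolynomial.coeff_C_mul, MvPolynomial.coeff_add, MvPolynomial.coeff_monomial, if_pos rfl,
      MvPolynomial.coeff_monomial, mul_eq_zero, mul_eq_zero] at hc
    rcases hc with (hc | hc) | hc
    · exact hc
    · exact absurd hc (Gen.sign_ne_zero hj)
    · split_ifs at hc <;> norm_num at hc
  · intro j' _ hne
    rw [MvPolynomial.coeff_C_mul, MvPolynomial.coeff_add, MvPolynomial.coeff_monomial,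
      MvPolynomial.coeff_monomial, if_neg, if_neg]
    · simp
    · rw [hm]
      rintro ⟨h1, h2⟩
      have h3 := j.1.degrees_le
      have h4 := j'.1.degrees_le
      exact hne (Subtype.ext (Gen.degrees_injective (Prod.ext (by omega) (by omega))))
    · rw [hm]
      rintro ⟨h1, h2⟩
      exact hne (Subtype.ext (Gen.degrees_injective (Prod.ext h1 h2)))
  · simp

theorem exists_mem_span_pairVec (J : Finset Gen) {w : Gen → ℚ} (hw : w .z = 0) :
    ∃ h ∈ Submodule.span ℚ (Set.range pairVec), ∀ j ∈ J, h j = w j := by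
  classical
  let ρ : (Gen → ℚ) →ₗ[ℚ] (J → ℚ) := LinearMap.funLeft ℚ ℚ Subtype.val
  by_cases hmem : ρ w ∈ (Submodule.span ℚ (Set.range pairVec)).map ρ
  · obtain ⟨h, hh, heq⟩ := hmem
    exact ⟨h, hh, fun j hj => congrFun heq ⟨j, hj⟩⟩
  · obtain ⟨f, hf, hle⟩ := Submodule.exists_le_ker_of_notMem hmem
    refine absurd ?_ hf
    have hc := coeff_eq_zero_of_sum_pairVec (J := J)
      (c := fun i => f fun j => if i = j then 1 else 0) fun T => by
        have h1 : f (ρ (pairVec T)) = 0 :=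
          hle (Submodule.mem_map_of_mem (Submodule.subset_span ⟨T, rfl⟩))
        rw [LinearMap.pi_apply_eq_sum_univ] at h1
        exact h1
    rw [LinearMap.pi_apply_eq_sum_univ]
    refine Finset.sum_eq_zero fun j _ => ?_
    by_cases hj : j.1 = .z
    · have : ρ w j = 0 := by
        change w j.1 = 0
        rw [hj, hw]
      rw [this, zero_smul]
    · rw [hc j hj, smul_zero]

theorem powerFamily_independent {H : MvPolynomial Gen ℚ}
    (hH : MvPolynomial.aeval powerFamily H = 0) : H = 0 := by
  refine MvPolynomial.funext fun w => ?_
  rw [map_zero]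
  have hbase : ∀ u ∈ AddSubmonoid.closure (Set.range pairVec),
      MvPolynomial.eval (baseVec (-w .z) + u) H = 0 := by
    intro u hu
    obtain ⟨N, T, rfl⟩ := exists_sum_pairVec hu
    obtain ⟨S, x, hS⟩ := hasValue_powerFamily (-w .z) T N
    have h := HasValue.aeval hS H
    rw [hH] at h
    exact h.unique ⟨0, by simp, by simp⟩
  obtain ⟨h, hh, hJ⟩ := exists_mem_span_pairVec H.vars (w := w - baseVec (-w .z))
    (by simp [baseVec])
  rw [← eval_eq_zero_of_mem_span hh _ hbase 0 (zero_mem _)]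
  refine MvPolynomial.hom_congr_vars (by ext; simp) (fun g hg _ => ?_) rfl
  simp [hJ g hg]

/-! ### Algebraic independence of the augmented elementary basis -/

/-- The augmented elementary basis as polynomials in `powerFamily`. -/
noncomputable def elementaryToPower : MvPolynomial Gen ℚ →ₐ[ℚ] MvPolynomial Gen ℚ :=
  MvPolynomial.aeval fun g => match g with
    | .e n _ => newtonE (fun i => MvPolynomial.X (.e (i + 1) (by omega))) n
    | g => MvPolynomial.X g

/-- `powerFamily` as polynomials in the augmented elementary basis. -/
noncomputable def powerToElementary : MvPolynomial Gen ℚ →ₐ[ℚ] MvPolynomial Gen ℚ :=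
  MvPolynomial.aeval fun g => match g with
    | .e n _ => newtonP (fun i => if h : 1 ≤ i then MvPolynomial.X (.e i h) else 1) (n - 1)
    | g => MvPolynomial.X g

theorem powerToElementary_elementaryToPower (F : MvPolynomial Gen ℚ) :
    powerToElementary (elementaryToPower F) = F := by
  have : powerToElementary.comp elementaryToPower = AlgHom.id ℚ _ := by
    refine MvPolynomial.algHom_ext fun g => ?_
    rcases g with ⟨n, hn⟩ | ⟨a, b, hb, hab⟩ | _
    · simp only [elementaryToPower, AlgHom.comp_apply, MvPolynomial.aeval_X, map_newtonE]
      simp only [powerToElementary, MvPolynomial.aeval_X, Nat.add_sub_cancel]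
      rw [newtonE_newtonP (by simp)]
      simp [hn]
    all_goals simp [elementaryToPower, powerToElementary]
  exact AlgHom.congr_fun this F

theorem aeval_powerFamily (F : MvPolynomial Gen ℚ) :
    MvPolynomial.aeval powerFamily (elementaryToPower F) = MvPolynomial.aeval Gen.toSeries F := by
  have : (MvPolynomial.aeval powerFamily).comp elementaryToPower =
      MvPolynomial.aeval Gen.toSeries := by
    refine MvPolynomial.algHom_ext fun g => ?_
    rcases g with ⟨n, hn⟩ | ⟨a, b, hb, hab⟩ | _
    · simp only [elementaryToPower, AlgHom.comp_apply, MvPolynomial.aeval_X, map_newtonE,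
        powerFamily, Gen.toSeries]
      exact (eq_newtonE e_zero newton_identity n).symm
    all_goals simp [elementaryToPower, powerFamily, Gen.toSeries]
  exact AlgHom.congr_fun this F

/-- The augmented elementary `B`-symmetric basis is algebraically independent. -/
theorem aeval_toSeries_injective :
    Function.Injective (MvPolynomial.aeval Gen.toSeries :
      MvPolynomial Gen ℚ →ₐ[ℚ] MvPowerSeries ℤ ℚ) := by
  intro F F' h
  rw [← aeval_powerFamily, ← aeval_powerFamily, ← sub_eq_zero, ← map_sub, ← map_sub] at h
  have h' := powerFamily_independent h
  rw [map_sub, sub_eq_zero] at h'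
  rw [← powerToElementary_elementaryToPower F, h', powerToElementary_elementaryToPower]

end BSymmetric

namespace SignedGraph

open SignedPoint

variable {V : Type u} {E : Type v} {G : SignedGraph V E}

/-! ### Acyclic orientations and potentials -/

namespace Orientation

/-- The arrow on a half-edge as a sign: `1` if it points toward its vertex. -/
def arrow (O : G.Orientation) (e : E) (b : Bool) : ℤ := if O.toward e b then 1 else -1

theorem toward_true_eq (O : G.Orientation) (e : E) :
    O.toward e true = if G.sgn e = 1 then !O.toward e false else O.toward e false := by
  rcases Int.units_eq_one_or (G.sgn e) with h | h
  · have := O.positive e h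
    rw [if_pos h]
    cases h1 : O.toward e false <;> cases h2 : O.toward e true <;> simp_all
  · rw [if_neg (by rw [h]; decide), O.negative e h]

theorem arrow_true (O : G.Orientation) (e : E) :
    O.arrow e true = -(G.sgn e : ℤ) * O.arrow e false := by
  rw [arrow, toward_true_eq, arrow]
  rcases Int.units_eq_one_or (G.sgn e) with h | h <;> rw [h] <;> cases O.toward e false <;>
    simp

/-- An orientation is determined by its arrows at one half of each edge. -/
theorem ext_of_exists {O O' : G.Orientation} (h : ∀ e, ∃ b, O.toward e b = O'.toward e b) :
    O = O' := by
  have h' : O.toward = O'.toward := by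
    have hf : ∀ e, O.toward e false = O'.toward e false := fun e => by
      obtain ⟨b, hb⟩ := h e
      cases b
      · exact hb
      · rw [toward_true_eq, toward_true_eq] at hb
        split_ifs at hb
        · exact Bool.not_inj hb
        · exact hb
    funext e b
    cases b
    · exact hf e
    · rw [toward_true_eq, toward_true_eq, hf]
  rcases O with ⟨t, _, _⟩
  rcases O' with ⟨t', _, _⟩
  cases h'
  rfl

/-- The potential `φ` is compatible with the edge `e`: the sum of its values at the two ends of `e`,
with the signs given by the arrows, is positive. In the signed vector space `ℤ ^ V` this says that
the vector of the oriented edge has a positive inner product with `φ`. -/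
def Compatible (O : G.Orientation) (φ : V → ℤ) (e : E) : Prop :=
  0 < O.arrow e false * φ (G.ends e false) + O.arrow e true * φ (G.ends e true)

theorem Compatible.half {O : G.Orientation} {φ : V → ℤ} {e : E} (h : O.Compatible φ e) (b : Bool) :
    0 < O.arrow e b * φ (G.ends e b) + O.arrow e (!b) * φ (G.ends e !b) := by
  unfold Compatible at h
  cases b
  · exact h
  · rw [add_comm]
    exact h

theorem abs_arrow_mul (O : G.Orientation) (e : E) (b : Bool) (a : ℤ) : |O.arrow e b * a| = |a| := by
  rw [arrow]
  split_ifs <;> simp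

theorem compatible_iff {O : G.Orientation} {φ : V → ℤ} {e : E} :
    O.Compatible φ e ↔ if O.toward e false then
      (G.sgn e : ℤ) * φ (G.ends e true) < φ (G.ends e false) else
        φ (G.ends e false) < (G.sgn e : ℤ) * φ (G.ends e true) := by
  rw [Compatible, arrow_true, arrow]
  split_ifs <;> constructor <;> intro h <;> linarith

/-- A cycle has no compatible potential: from a vertex of the cycle where `|φ|` is maximal, an
arrow with the sign opposite to that of `φ` would lead to a vertex of the cycle with a larger
value of `|φ|`. -/
theorem isAcyclic_of_compatible {O : G.Orientation} {φ : V → ℤ} (h : ∀ e, O.Compatible φ e) :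
    O.IsAcyclic := by
  intro w hw
  obtain ⟨i, hi, hmax⟩ := Finset.exists_max_image (Finset.range (w.length + 1))
    (fun i => |φ (w.vert i)|) ⟨0, by simp⟩
  rw [Finset.mem_range, Nat.lt_succ_iff] at hi
  obtain ⟨⟨j₁, b₁, hj₁, ht₁⟩, ⟨j₂, b₂, hj₂, ht₂⟩⟩ := hw i hi
  obtain ⟨j, b, hj, ha⟩ : ∃ (j : Fin w.length) (b : Bool), G.ends (w.edge j) b = w.vert i ∧
      O.arrow (w.edge j) b * φ (w.vert i) ≤ -|φ (w.vert i)| := by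
    rcases le_total 0 (φ (w.vert i)) with h0 | h0
    · exact ⟨j₂, b₂, hj₂, by simp [arrow, ht₂, abs_of_nonneg h0]⟩
    · exact ⟨j₁, b₁, hj₁, by simp [arrow, ht₁, abs_of_nonpos h0]⟩
  obtain ⟨i', hi', hv⟩ : ∃ i' ≤ w.length, G.ends (w.edge j) (!b) = w.vert i' := by
    obtain ⟨b', h1, h2⟩ := w.joins j
    have := j.2
    rcases Bool.eq_or_eq_not b b' with rfl | rfl
    · exact ⟨j + 1, by omega, h2⟩
    · exact ⟨j, by omega, by rw [Bool.not_not]; exact h1⟩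
  have h1 := (h (w.edge j)).half b
  have h2 := hmax i' (by simpa [Nat.lt_succ_iff] using hi')
  have h3 := le_abs_self (O.arrow (w.edge j) (!b) * φ (w.vert i'))
  rw [abs_arrow_mul] at h3
  rw [hj, hv] at h1
  linarith

/-- In an acyclic orientation every nonempty set `F` of edges has a vertex at which all the arrows
of `F` have the same direction. Otherwise a walk could be continued indefinitely within `F`, leaving
each vertex along an arrow opposite to the one along which it arrived, and such a walk contains a
cycle. -/
theorem IsAcyclic.exists_uniform [Finite E] {O : G.Orientation} (hO : O.IsAcyclic) {F : Set E}
    (hF : F.Nonempty) : ∃ x d, (∃ e ∈ F, ∃ b, G.ends e b = x) ∧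
      ∀ e ∈ F, ∀ b, G.ends e b = x → O.toward e b = d := by
  by_contra! hcon
  have hnext : ∀ h : {h : E × Bool // h.1 ∈ F}, ∃ h' : {h : E × Bool // h.1 ∈ F},
      G.ends h'.1.1 h'.1.2 = G.ends h.1.1 (!h.1.2) ∧
        O.toward h'.1.1 h'.1.2 ≠ O.toward h.1.1 (!h.1.2) := by
    rintro ⟨⟨e, b⟩, he⟩
    obtain ⟨e', he', b', h1, h2⟩ := hcon (G.ends e !b) (O.toward e !b) ⟨e, he, !b, rfl⟩
    exact ⟨⟨(e', b'), he'⟩, h1, h2⟩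
  choose next hends htoward using hnext
  obtain ⟨e₀, he₀⟩ := hF
  let a : ℕ → {h : E × Bool // h.1 ∈ F} := fun n => next^[n] ⟨(e₀, false), he₀⟩
  have ha : ∀ n, a (n + 1) = next (a n) := fun n => Function.iterate_succ_apply' _ _ _
  obtain ⟨m, n, hmn, heq⟩ : ∃ m n, m < n ∧ a m = a n := by
    obtain ⟨m, n, hne, heq⟩ := Finite.exists_ne_map_eq_of_infinite a
    rcases lt_or_gt_of_ne hne with h | h
    · exact ⟨m, n, h, heq⟩
    · exact ⟨n, m, h, heq.symm⟩
  have hstep : ∀ i, G.ends (a i).1.1 (!(a i).1.2) = G.ends (a (i + 1)).1.1 (a (i + 1)).1.2 :=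
    fun i => by rw [ha, hends]
  have hopp : ∀ i, O.toward (a (i + 1)).1.1 (a (i + 1)).1.2 ≠ O.toward (a i).1.1 (!(a i).1.2) :=
    fun i => by
      rw [ha]
      exact htoward _
  let w : G.ClosedWalk :=
    { length := n - m
      vert := fun i => G.ends (a (m + i)).1.1 (a (m + i)).1.2
      edge := fun i => (a (m + i)).1.1
      joins := fun i => ⟨(a (m + i)).1.2, rfl, hstep _⟩
      closed := by
        have h : m + (n - m) = n := by omega
        simp only [h, add_zero, heq] }
  refine hO w fun i hi => ?_
  -- the arrows by which the walk leaves and enters its vertex number `i`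
  obtain ⟨j, j', h1, h2, h3⟩ : ∃ j j' : Fin (n - m),
      G.ends (a (m + j)).1.1 (a (m + j)).1.2 = w.vert i ∧
      G.ends (a (m + j')).1.1 (!(a (m + j')).1.2) = w.vert i ∧
      O.toward (a (m + j)).1.1 (a (m + j)).1.2 ≠
        O.toward (a (m + j')).1.1 (!(a (m + j')).1.2) := by
    by_cases hi' : 0 < i ∧ i < n - m
    · refine ⟨⟨i, hi'.2⟩, ⟨i - 1, by omega⟩, rfl, ?_, ?_⟩
      · have h : m + i = m + (i - 1) + 1 := by omega
        change _ = G.ends (a (m + i)).1.1 (a (m + i)).1.2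
        rw [h]
        exact hstep _
      · have h : m + i = m + (i - 1) + 1 := by omega
        simp only [h]
        exact hopp _
    · have hv : w.vert i = G.ends (a m).1.1 (a m).1.2 := by
        have hi2 : i ≤ n - m := hi
        obtain h | h : m + i = m ∨ m + i = n := by omega
        · change G.ends (a (m + i)).1.1 (a (m + i)).1.2 = _
          rw [h]
        · change G.ends (a (m + i)).1.1 (a (m + i)).1.2 = _
          rw [h, heq]
      have h : n = m + (n - m - 1) + 1 := by omega
      have hm : a m = a (m + (n - m - 1) + 1) := by rw [← h, heq]
      refine ⟨⟨0, by omega⟩, ⟨n - m - 1, by omega⟩, by rw [hv]; rfl, ?_, ?_⟩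
      · rw [hv, hm]
        exact hstep _
      · simp only [add_zero]
        rw [hm]
        exact hopp _
  cases h4 : O.toward (a (m + j)).1.1 (a (m + j)).1.2
  · refine ⟨⟨j', _, h2, ?_⟩, ⟨j, _, h1, h4⟩⟩
    rw [h4] at h3
    simpa using h3.symm
  · refine ⟨⟨j, _, h1, h4⟩, ⟨j', _, h2, ?_⟩⟩
    rw [h4] at h3
    simpa using h3.symm

/-- An acyclic orientation has a compatible potential: remove the edges at a vertex where all the
arrows agree, and give that vertex a large value of the right sign. -/
theorem IsAcyclic.exists_compatible [Fintype V] [Finite E] {O : G.Orientation} (hO : O.IsAcyclic) :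
    ∃ φ, ∀ e, O.Compatible φ e := by
  classical
  have := Fintype.ofFinite E
  suffices h : ∀ F : Finset E, ∃ φ, ∀ e ∈ F, O.Compatible φ e by
    obtain ⟨φ, hφ⟩ := h Finset.univ
    exact ⟨φ, fun e => hφ e (Finset.mem_univ e)⟩
  intro F
  induction F using Finset.strongInduction with
  | H F ih =>
    rcases F.eq_empty_or_nonempty with rfl | hF
    · exact ⟨0, by simp⟩
    · obtain ⟨x, d, ⟨e₀, he₀, b₀, hx⟩, hd⟩ := hO.exists_uniform (F := (F : Set E)) hF
      obtain ⟨φ, hφ⟩ := ih (F.filter fun e => ∀ b, G.ends e b ≠ x) <| by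
        refine Finset.filter_ssubset.2 ⟨e₀, he₀, fun h => h b₀ hx⟩
      set M : ℤ := 1 + ∑ y, |φ y| with hM
      have hlt : ∀ y, |φ y| < M := fun y => by
        have := Finset.single_le_sum (f := fun y => |φ y|) (fun _ _ => abs_nonneg _)
          (Finset.mem_univ y)
        linarith
      refine ⟨Function.update φ x ((if d then 1 else -1) * M), fun e he => ?_⟩
      by_cases hex : ∃ b, G.ends e b = x
      · obtain ⟨b, hb⟩ := hex
        have hval : ∀ b, G.ends e b = x →
            O.arrow e b * Function.update φ x ((if d then 1 else -1) * M) (G.ends e b) = M := by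
          intro b hb
          rw [hb, Function.update_self, arrow, hd e he b hb]
          cases d <;> simp
        have hM0 : 0 < M := (abs_nonneg _).trans_lt (hlt x)
        have hoth : ∀ b, -M <
            O.arrow e b * Function.update φ x ((if d then 1 else -1) * M) (G.ends e b) := by
          intro b
          by_cases hb : G.ends e b = x
          · rw [hval b hb]
            linarith
          · rw [Function.update_of_ne hb]
            have h1 := abs_arrow_mul O e b (φ (G.ends e b))
            have h2 := neg_abs_le (O.arrow e b * φ (G.ends e b))
            have h3 := hlt (G.ends e b)
            linarith
        have h1 := hval b hb
        have h2 := hoth !b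
        unfold Compatible
        cases b <;> simp only [Bool.not_false, Bool.not_true] at h2 <;> linarith
      · push Not at hex
        have h := hφ e (Finset.mem_filter.2 ⟨he, hex⟩)
        unfold Compatible at h ⊢
        rwa [Function.update_of_ne (hex _), Function.update_of_ne (hex _)]

/-- The orientation of a signed graph given by a proper coloring: on each edge, the one with which
the coloring is compatible. -/
def ofProper {φ : V → ℤ} (_h : G.IsProper φ) : G.Orientation where
  toward e b := match b with
    | false => decide ((G.sgn e : ℤ) * φ (G.ends e true) < φ (G.ends e false))
    | true => if G.sgn e = 1 then
        !decide ((G.sgn e : ℤ) * φ (G.ends e true) < φ (G.ends e false)) else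
          decide ((G.sgn e : ℤ) * φ (G.ends e true) < φ (G.ends e false))
  positive e he := by simp [he]
  negative e he := by
    have : ¬ (-1 : ℤˣ) = 1 := by decide
    simp [he, this]

theorem compatible_ofProper {φ : V → ℤ} (h : G.IsProper φ) (e : E) :
    (ofProper h).Compatible φ e := by
  have h' := (G.isProper_iff φ).1 h e
  rw [compatible_iff]
  simp only [ofProper, decide_eq_true_eq]
  split_ifs with h1
  · exact h1
  · exact lt_of_le_of_ne (not_lt.1 h1) h'

end Orientation

/-! ### Deleting a set of vertices -/

section Deletion

variable [DecidableEq V] [Fintype E] (G) (U : Finset V)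

/-- No positive edge has both ends in `U`. -/
def PosIndependent : Prop :=
  ∀ e, G.sgn e = 1 → ¬ (G.ends e false ∈ U ∧ G.ends e true ∈ U)

/-- The edges that are left when the vertices in `U` are deleted. -/
def remainingEdges : Finset E :=
  Finset.univ.filter fun e => G.ends e false ∉ U ∧ G.ends e true ∉ U

/-- The left-hand side of the constraint of an edge in the graph without the vertices in `U`. The
value at edges that are not in `remainingEdges` plays no role. -/
def leftPoint (e : E) : SignedPoint {x // x ∉ U} :=
  if h : G.ends e false ∉ U then some (1, ⟨_, h⟩) else none

/-- The right-hand side of the constraint of an edge in the graph without the vertices in `U`. -/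
def rightPoint (e : E) : SignedPoint {x // x ∉ U} :=
  if h : G.ends e true ∉ U then some (G.sgn e, ⟨_, h⟩) else none

/-- The extension of an assignment to all vertices by the value `M` on `U`. -/
def extendBy {U : Finset V} (M : ℤ) (ψ : {x // x ∉ U} → ℤ) (x : V) : ℤ :=
  if h : x ∉ U then ψ ⟨x, h⟩ else M

variable {G U}

theorem mem_remainingEdges {e : E} :
    e ∈ G.remainingEdges U ↔ G.ends e false ∉ U ∧ G.ends e true ∉ U := by
  simp [remainingEdges]

theorem ev_points {e : E} (he : e ∈ G.remainingEdges U) {φ : V → ℤ} {ψ : {x // x ∉ U} → ℤ}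
    (h : ∀ x : {x // x ∉ U}, φ x = ψ x) : ev (G.leftPoint U e) ψ = φ (G.ends e false) ∧
      ev (G.rightPoint U e) ψ = (G.sgn e : ℤ) * φ (G.ends e true) := by
  rw [mem_remainingEdges] at he
  constructor
  · simp [leftPoint, he.1, ev, ← h]
  · simp [rightPoint, he.2, ev, ← h]

theorem extendBy_of_mem {M : ℤ} {ψ : {x // x ∉ U} → ℤ} {x : V} (hx : x ∈ U) :
    extendBy M ψ x = M := by
  simp [extendBy, hx]

theorem extendBy_coe {M : ℤ} {ψ : {x // x ∉ U} → ℤ} (x : {x // x ∉ U}) :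
    extendBy M ψ x = ψ x := by
  simp [extendBy, x.2]

theorem isProper_extendBy {M : ℤ} (hM : 0 < M) {ψ : {x // x ∉ U} → ℤ} (hψ : ∀ x, |ψ x| < M) :
    G.IsProper (extendBy M ψ) ↔ G.PosIndependent U ∧
      Avoids (G.leftPoint U) (G.rightPoint U) (G.remainingEdges U) ψ := by
  have hlt : ∀ x, x ∉ U → |extendBy M ψ x| < M := fun x hx => by
    simpa [extendBy, hx] using hψ ⟨x, hx⟩
  rw [isProper_iff]
  constructor
  · refine fun h => ⟨fun e he hU => ?_, fun e he => ?_⟩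
    · refine h e ?_
      rw [extendBy_of_mem hU.1, extendBy_of_mem hU.2, he]
      simp
    · obtain ⟨h1, h2⟩ := ev_points he (φ := extendBy M ψ) extendBy_coe
      rw [h1, h2]
      exact h e
  · rintro ⟨hind, hav⟩ e
    by_cases h1 : G.ends e false ∈ U <;> by_cases h2 : G.ends e true ∈ U
    · rw [extendBy_of_mem h1, extendBy_of_mem h2]
      rcases Int.units_eq_one_or (G.sgn e) with h | h
      · exact absurd ⟨h1, h2⟩ (hind e h)
      · rw [h]
        simp
        omega
    · have := abs_lt.1 (hlt _ h2)
      rw [extendBy_of_mem h1]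
      rcases Int.units_eq_one_or (G.sgn e) with h | h <;> rw [h] <;> simp <;> omega
    · have := abs_lt.1 (hlt _ h1)
      rw [extendBy_of_mem h2]
      rcases Int.units_eq_one_or (G.sgn e) with h | h <;> rw [h] <;> simp <;> omega
    · have he : e ∈ G.remainingEdges U := mem_remainingEdges.2 ⟨h1, h2⟩
      obtain ⟨h3, h4⟩ := ev_points he (φ := extendBy M ψ) extendBy_coe
      rw [← h3, ← h4]
      exact hav e he

/-- The acyclic orientations in which all vertices in `U` are sinks correspond to the regions of the
graph without `U`. There are none if a positive edge joins two vertices of `U`. -/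
theorem card_acyclic_sinks [Fintype V] [Decidable (G.PosIndependent U)] :
    Nat.card {O : G.Orientation // O.IsAcyclic ∧ ∀ x ∈ U, O.IsSink x} =
      if G.PosIndependent U then
        (regions (G.leftPoint U) (G.rightPoint U) (G.remainingEdges U)).card else 0 := by
  classical
  split_ifs with hind
  · rw [← Fintype.card_coe, ← Nat.card_eq_fintype_card]
    have hmem : ∀ O : {O : G.Orientation // O.IsAcyclic ∧ ∀ x ∈ U, O.IsSink x},
        (G.remainingEdges U).filter (fun e => O.1.toward e false) ∈
          regions (G.leftPoint U) (G.rightPoint U) (G.remainingEdges U) := by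
      rintro ⟨O, hO, -⟩
      obtain ⟨φ, hφ⟩ := hO.exists_compatible
      refine Finset.mem_filter.2 ⟨Finset.mem_powerset.2 (Finset.filter_subset _ _),
        fun x => φ x, fun e he => ?_⟩
      obtain ⟨h1, h2⟩ := ev_points he (φ := φ) (ψ := fun x => φ x) fun _ => rfl
      have h3 := Orientation.compatible_iff.1 (hφ e)
      rw [h1, h2, Finset.mem_filter, and_iff_right he]
      split_ifs at h3 with h4 <;> simp [h4, h3]
    refine Nat.card_eq_of_bijective (fun O => ⟨_, hmem O⟩) ⟨?_, ?_⟩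
    · rintro ⟨O, hO, hs⟩ ⟨O', hO', hs'⟩ heq
      refine Subtype.ext (Orientation.ext_of_exists fun e => ?_)
      by_cases h1 : G.ends e false ∈ U
      · exact ⟨false, by rw [hs _ h1 e false rfl, hs' _ h1 e false rfl]⟩
      by_cases h2 : G.ends e true ∈ U
      · exact ⟨true, by rw [hs _ h2 e true rfl, hs' _ h2 e true rfl]⟩
      refine ⟨false, ?_⟩
      have h3 := Finset.ext_iff.1 (Subtype.ext_iff.1 heq) e
      simp only [Finset.mem_filter, mem_remainingEdges, h1, h2, not_false_iff, and_self,
        true_and] at h3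
      exact Bool.eq_iff_iff.2 h3
    · rintro ⟨T, hT⟩
      obtain ⟨hT, ψ, hψ⟩ := Finset.mem_filter.1 hT
      rw [Finset.mem_powerset] at hT
      set M : ℤ := 1 + ∑ x, |ψ x| with hM
      have hlt : ∀ x, |ψ x| < M := fun x => by
        have := Finset.single_le_sum (f := fun x => |ψ x|) (fun _ _ => abs_nonneg _)
          (Finset.mem_univ x)
        linarith
      have hM0 : 0 < M := by
        have := Finset.sum_nonneg (s := Finset.univ) fun x _ => abs_nonneg (ψ x)
        linarith
      have hle : ∀ x, |extendBy M ψ x| ≤ M := fun x => by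
        by_cases hx : x ∈ U
        · rw [extendBy_of_mem hx, abs_of_pos hM0]
        · simpa [extendBy, hx] using (hlt ⟨x, hx⟩).le
      have hproper : G.IsProper (extendBy M ψ) := (isProper_extendBy hM0 hlt).2 ⟨hind, by
        intro e he
        by_cases heT : e ∈ T
        · exact ((hψ e he).1 heT).ne'
        · exact ((hψ e he).2 heT).ne⟩
      have hcomp := Orientation.compatible_ofProper hproper
      refine ⟨⟨Orientation.ofProper hproper, Orientation.isAcyclic_of_compatible hcomp, ?_⟩, ?_⟩
      · intro x hx e b hb
        by_contra hfalse
        have h1 := (hcomp e).half b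
        have h2 := Orientation.abs_arrow_mul (Orientation.ofProper hproper) e (!b)
          (extendBy M ψ (G.ends e !b))
        have h3 := le_abs_self ((Orientation.ofProper hproper).arrow e (!b) *
          extendBy M ψ (G.ends e !b))
        have h4 := hle (G.ends e !b)
        rw [hb, extendBy_of_mem hx, Orientation.arrow, if_neg hfalse] at h1
        linarith
      · refine Subtype.ext (Finset.ext fun e => ?_)
        rw [Finset.mem_filter]
        by_cases he : e ∈ G.remainingEdges U
        · obtain ⟨h1, h2⟩ := ev_points he (φ := extendBy M ψ) extendBy_coe
          have h3 := hψ e he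
          rw [h1, h2] at h3
          simp only [he, true_and, Orientation.ofProper, decide_eq_true_eq]
          by_cases heT : e ∈ T
          · simp [heT, h3.1 heT]
          · simp [heT, (h3.2 heT).le]
        · simp only [he, false_and, false_iff]
          exact fun h => he (hT h)
  · have : IsEmpty {O : G.Orientation // O.IsAcyclic ∧ ∀ x ∈ U, O.IsSink x} := by
      refine ⟨fun O => hind fun e he hU => O.1.positive e he ?_⟩
      rw [O.2.2 _ hU.1 e false rfl, O.2.2 _ hU.2 e true rfl]
    simp

/-- The proper colorings with values in `{-k, …, k + 1}` that take the value `k + 1` exactly on `U`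
correspond to the colorings of the graph without `U` with values in `{-k, …, k}`, since no vertex
has the color `-(k + 1)`. -/
theorem card_proper_colorings [Decidable (G.PosIndependent U)] (k : ℕ) :
    Nat.card {κ : V → ℤ // (∀ x, κ x ∈ Finset.Icc (-(k : ℤ)) (k + 1)) ∧ G.IsProper κ ∧
        ∀ x, κ x = k + 1 ↔ x ∈ U} =
      if G.PosIndependent U then
        boxCount (G.leftPoint U) (G.rightPoint U) (G.remainingEdges U) k else 0 := by
  have hM : (0 : ℤ) < k + 1 := by positivity
  have e1 : {κ : V → ℤ // (∀ x, κ x ∈ Finset.Icc (-(k : ℤ)) (k + 1)) ∧ G.IsProper κ ∧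
      ∀ x, κ x = k + 1 ↔ x ∈ U} ≃ {ψ : {x // x ∉ U} → ℤ // (∀ x, |ψ x| ≤ k) ∧
        G.PosIndependent U ∧
          Avoids (G.leftPoint U) (G.rightPoint U) (G.remainingEdges U) ψ} := by
    have hext : ∀ κ : V → ℤ, (∀ x, κ x = k + 1 ↔ x ∈ U) →
        extendBy (U := U) (k + 1) (fun x => κ x) = κ := fun κ hκ => funext fun x => by
      by_cases hx : x ∈ U
      · rw [extendBy_of_mem hx, (hκ x).2 hx]
      · simp [extendBy, hx]
    refine
      { toFun := fun κ => ⟨fun x => κ.1 x, ?_⟩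
        invFun := fun ψ => ⟨extendBy (k + 1) ψ.1, ?_⟩
        left_inv := fun κ => Subtype.ext (hext κ.1 κ.2.2.2)
        right_inv := fun ψ => Subtype.ext (funext fun x => extendBy_coe x) }
    · obtain ⟨κ, h1, h2, h3⟩ := κ
      have hle : ∀ x : {x // x ∉ U}, |κ x| ≤ k := fun x => by
        have h4 := Finset.mem_Icc.1 (h1 x)
        have h5 := mt (h3 x).1 x.2
        rw [abs_le]
        omega
      refine ⟨hle, (isProper_extendBy hM fun x => ?_).1 ?_⟩
      · exact (hle x).trans_lt (by omega)
      · rw [hext κ h3]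
        exact h2
    · obtain ⟨ψ, h1, h2⟩ := ψ
      have hlt : ∀ x, |ψ x| < (k + 1 : ℤ) := fun x => (h1 x).trans_lt (by omega)
      refine ⟨fun x => ?_, (isProper_extendBy hM hlt).2 h2, fun x => ?_⟩
      · by_cases hx : x ∈ U
        · rw [extendBy_of_mem hx, Finset.mem_Icc]
          omega
        · have := abs_le.1 (h1 ⟨x, hx⟩)
          simp only [extendBy, hx, not_false_iff, dif_pos, Finset.mem_Icc]
          omega
      · by_cases hx : x ∈ U
        · simp [extendBy_of_mem hx, hx]
        · have := abs_le.1 (h1 ⟨x, hx⟩)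
          simp only [extendBy, hx, not_false_iff, dif_pos, iff_false]
          omega
  rw [Nat.card_congr e1]
  split_ifs with hind
  · exact Nat.card_congr (Equiv.subtypeEquivRight fun ψ => by simp [hind])
  · have : IsEmpty {ψ : {x // x ∉ U} → ℤ // (∀ x, |ψ x| ≤ k) ∧
        G.PosIndependent U ∧
          Avoids (G.leftPoint U) (G.rightPoint U) (G.remainingEdges U) ψ} := ⟨fun ψ => hind ψ.2.2.1⟩
    exact Nat.card_of_isEmpty

end Deletion

end SignedGraph

namespace BSymmetric

/-! ### The specialization -/

open Polynomial in
/-- The binomial coefficient `N.choose n` as a polynomial in `N`. -/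
noncomputable def choosePoly (n : ℕ) : Polynomial ℚ :=
  C (1 / (n.factorial : ℚ)) * descPochhammer ℚ n

theorem eval_choosePoly (n N : ℕ) : (choosePoly n).eval (N : ℚ) = N.choose n := by
  rw [choosePoly, Polynomial.eval_mul, Polynomial.eval_C, descPochhammer_eval_eq_descFactorial,
    Nat.descFactorial_eq_factorial_mul_choose]
  have := Nat.factorial_ne_zero n
  push_cast
  field_simp

theorem eval_neg_one_choosePoly (n : ℕ) : (choosePoly n).eval (-1) = (-1) ^ n := by
  have h : (descPochhammer ℚ n).eval (-1) = (-1) ^ n * n.factorial := by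
    induction n with
    | zero => simp
    | succ n ih =>
      rw [descPochhammer_succ_right, Polynomial.eval_mul, ih, Nat.factorial_succ]
      simp
      ring
  rw [choosePoly, Polynomial.eval_mul, Polynomial.eval_C, h]
  have := Nat.factorial_ne_zero n
  field_simp

/-- The point at which the series are evaluated: `x_{k + 1} = t - 1`, and `x_i = -1` otherwise (only
the indices from `-k` to `k + 1` matter). -/
def specialPoint (t : ℚ) (k : ℕ) (i : ℤ) : ℚ := if i = k + 1 then t - 1 else -1

/-- The values of the augmented elementary basis at `specialPoint`, as polynomials in the number
`N = 2 * k + 1` of variables with value `-1`. -/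
noncomputable def specialPoly (t : ℚ) : Gen → Polynomial ℚ
  | .e n _ => Polynomial.C ((-1) ^ n) * choosePoly n +
      Polynomial.C ((t - 1) * (-1) ^ (n - 1)) * choosePoly (n - 1)
  | .q _ _ _ _ => -Polynomial.X
  | .z => 1

theorem Icc_succ_eq_insert (k : ℕ) : Finset.Icc (-(k : ℤ)) (k + 1) =
    insert ((k : ℤ) + 1) (Finset.Icc (-(k : ℤ)) k) := by
  ext i
  simp only [Finset.mem_Icc, Finset.mem_insert]
  omega

theorem card_Icc_neg (k : ℕ) : (Finset.Icc (-(k : ℤ)) k).card = 2 * k + 1 := by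
  rw [Int.card_Icc]
  omega

theorem specialPoint_of_mem {t : ℚ} {k : ℕ} {i : ℤ} (hi : i ∈ Finset.Icc (-(k : ℤ)) k) :
    specialPoint t k i = -1 := by
  rw [Finset.mem_Icc] at hi
  rw [specialPoint, if_neg (by omega)]

theorem hasValue_toSeries (t : ℚ) (k : ℕ) (g : Gen) :
    HasValue (Finset.Icc (-(k : ℤ)) (k + 1)) (specialPoint t k) g.toSeries
      ((specialPoly t g).eval (2 * k + 1)) := by
  have hN : (2 * k + 1 : ℚ) = ((2 * k + 1 : ℕ) : ℚ) := by push_cast; rfl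
  rcases g with ⟨n, hn⟩ | ⟨a, b, hb, hab⟩ | _
  · obtain ⟨n, rfl⟩ : ∃ m, n = m + 1 := ⟨n - 1, by omega⟩
    refine Eq.subst (motive := HasValue _ _ _) ?_ (HasValue.e (n + 1))
    have hnot : (k : ℤ) + 1 ∉ Finset.Icc (-(k : ℤ)) k := by simp
    have hs : ∀ m, ∀ s ∈ (Finset.Icc (-(k : ℤ)) k).powersetCard m,
        ∏ i ∈ s, specialPoint t k i = (-1) ^ m := fun m s hs => by
      rw [Finset.mem_powersetCard] at hs
      rw [Finset.prod_congr rfl fun i hi => specialPoint_of_mem (hs.1 hi), Finset.prod_const, hs.2]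
    have hdisj : Disjoint ((Finset.Icc (-(k : ℤ)) k).powersetCard (n + 1))
        (((Finset.Icc (-(k : ℤ)) k).powersetCard n).image (insert ((k : ℤ) + 1))) := by
      rw [Finset.disjoint_left]
      rintro s h1 h2
      obtain ⟨s', -, rfl⟩ := Finset.mem_image.1 h2
      exact hnot ((Finset.mem_powersetCard.1 h1).1 (Finset.mem_insert_self _ _))
    have hnot' : ∀ s ∈ (Finset.Icc (-(k : ℤ)) k).powersetCard n, (k : ℤ) + 1 ∉ s :=
      fun s hs h => hnot ((Finset.mem_powersetCard.1 hs).1 h)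
    have hs' : ∀ s ∈ (Finset.Icc (-(k : ℤ)) k).powersetCard n,
        ∏ i ∈ insert ((k : ℤ) + 1) s, specialPoint t k i = (t - 1) * (-1) ^ n := fun s h => by
      rw [Finset.prod_insert (hnot' s h), hs n s h, specialPoint, if_pos rfl]
    rw [Icc_succ_eq_insert, Finset.powersetCard_succ_insert hnot, Finset.sum_union hdisj,
      Finset.sum_image, Finset.sum_congr rfl (hs (n + 1)), Finset.sum_congr rfl hs']
    · rw [Finset.sum_const, Finset.sum_const, Finset.card_powersetCard, Finset.card_powersetCard,
        card_Icc_neg]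
      simp only [specialPoly, Polynomial.eval_add, Polynomial.eval_mul, Polynomial.eval_C,
        Nat.add_sub_cancel, hN, eval_choosePoly, nsmul_eq_mul]
      ring
    · intro s hs s' hs' h
      rw [← Finset.erase_insert (hnot' s hs), ← Finset.erase_insert (hnot' s' hs'), h]
  · have h := (HasValue.p (S := Finset.Icc (-(k : ℤ)) (k + 1)) (x := specialPoint t k) (b := b)
      (show 1 ≤ a by omega) (Finset.Icc (-(k : ℤ)) k) fun i => by
        simp only [Finset.mem_Icc]
        omega).neg_one_pow_mul (a + b + 1)
    refine Eq.subst (motive := HasValue _ _ _) ?_ h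
    rw [Finset.sum_congr (g := fun _ => (-1 : ℚ) ^ (a + b)) rfl, Finset.sum_const, card_Icc_neg,
      nsmul_eq_mul, ← hN, mul_left_comm, ← pow_add]
    · have : Odd (a + b + 1 + (a + b)) := ⟨a + b, by ring⟩
      rw [this.neg_one_pow]
      simp [specialPoly]
    · intro i hi
      have hi' : -i ∈ Finset.Icc (-(k : ℤ)) k := by
        rw [Finset.mem_Icc] at hi ⊢
        omega
      rw [specialPoint_of_mem hi, specialPoint_of_mem hi', pow_add]
  · have h := HasValue.z (S := Finset.Icc (-(k : ℤ)) (k + 1)) (x := specialPoint t k)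
      (by simp only [Finset.mem_Icc]; omega)
    rw [specialPoint_of_mem (by simp)] at h
    simpa [specialPoly, Gen.toSeries] using h

/-- At `N = -1` the specialization sends `e_n` to `t` and all other elements of the basis to `1`. -/
theorem eval_specialPoly (t : ℚ) (F : MvPolynomial Gen ℚ) :
    MvPolynomial.eval (fun g => (specialPoly t g).eval (-1)) F =
      ∑ m ∈ F.support, F.coeff m * t ^ eFactors m := by
  rw [MvPolynomial.eval_eq]
  refine Finset.sum_congr rfl fun m _ => ?_
  rw [eFactors, Finsupp.sum, ← Finset.prod_pow_eq_pow_sum]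
  congr 1
  refine Finset.prod_congr rfl fun g _ => ?_
  rcases g with ⟨n, hn⟩ | ⟨a, b, hb, hab⟩ | _
  · obtain ⟨n, rfl⟩ : ∃ m, n = m + 1 := ⟨n - 1, by omega⟩
    congr 1
    simp only [specialPoly, Polynomial.eval_add, Polynomial.eval_mul, Polynomial.eval_C,
      eval_neg_one_choosePoly, Nat.add_sub_cancel]
    rw [mul_assoc, ← mul_pow, ← mul_pow]
    simp
  · simp [specialPoly]
  · simp [specialPoly]

theorem eval_aeval_specialPoly (t r : ℚ) (F : MvPolynomial Gen ℚ) :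
    (MvPolynomial.aeval (specialPoly t) F).eval r =
      MvPolynomial.eval (fun g => (specialPoly t g).eval r) F := by
  have : (Polynomial.evalRingHom r).comp
      (MvPolynomial.aeval (specialPoly t) : MvPolynomial Gen ℚ →ₐ[ℚ] _).toRingHom =
        MvPolynomial.eval fun g => (specialPoly t g).eval r :=
    MvPolynomial.ringHom_ext (fun a => by simp) fun g => by simp
  exact RingHom.congr_fun this F

theorem eval_neg_one_eq_zero {Q : Polynomial ℚ} (h : ∀ k : ℕ, Q.eval (2 * k + 1 : ℚ) = 0) :
    Q.eval (-1) = 0 := by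
  have h0 : Q.comp (2 * Polynomial.X + 1) = 0 := polynomial_eq_zero_of_nat fun k => by
    rw [Polynomial.eval_comp]
    simpa using h k
  have h1 := congrArg (Polynomial.eval (-1)) h0
  have h2 : Polynomial.eval (-1) (2 * Polynomial.X + 1 : Polynomial ℚ) = -1 := by
    simp
    norm_num
  rwa [Polynomial.eval_comp, Polynomial.eval_zero, h2] at h1

end BSymmetric

namespace SignedGraph

open BSymmetric SignedPoint

variable {V : Type u} {E : Type v} [Fintype V]

theorem numAcyclic_eq_zero (G : SignedGraph V E) {k : ℕ} (hk : Fintype.card V < k) : G.numAcyclic k = 0 := by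
  have : IsEmpty {O : G.Orientation // O.IsAcyclic ∧ Nat.card {x : V // O.IsSink x} = k} := by
    refine ⟨fun O => ?_⟩
    have h := Finite.card_subtype_le fun x => O.1.IsSink x
    rw [O.2.2, Nat.card_eq_fintype_card] at h
    omega
  exact Nat.card_of_isEmpty

variable [DecidableEq V] [Fintype E] (G : SignedGraph V E)

open Classical in
/-- The value of the chromatic `B`-symmetric function at `specialPoint`: the colorings are sorted by
the set `U` of vertices of color `k + 1`. -/
theorem hasValue_chromaticB (t : ℚ) (k : ℕ) :
    HasValue (Finset.Icc (-(k : ℤ)) (k + 1)) (specialPoint t k) G.chromaticB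
      (∑ U : Finset V, if G.PosIndependent U then (t - 1) ^ U.card *
        (-1) ^ Fintype.card {x // x ∉ U} *
          boxCount (G.leftPoint U) (G.rightPoint U) (G.remainingEdges U) k else 0) := by
  set S := Finset.Icc (-(k : ℤ)) (k + 1) with hS
  have hsupp : ∀ κ : V → ℤ, (∑ x, Finsupp.single (κ x) 1 : ℤ →₀ ℕ).support ⊆ S ↔ ∀ x, κ x ∈ S := by
    intro κ
    constructor
    · intro h x
      refine h (Finsupp.mem_support_iff.2 ?_)
      rw [Finsupp.finsetSum_apply]
      exact (Finset.sum_pos' (fun _ _ => Nat.zero_le _) ⟨x, Finset.mem_univ x, by simp⟩).ne'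
    · intro h i hi
      rw [Finsupp.mem_support_iff, Finsupp.finsetSum_apply] at hi
      obtain ⟨x, -, hx⟩ := Finset.exists_ne_zero_of_sum_ne_zero hi
      rw [Finsupp.single_apply] at hx
      split_ifs at hx with h'
      · exact h' ▸ h x
      · exact absurd rfl hx
  refine Eq.subst (motive := HasValue _ _ _) ?_ (HasValue.monomialSum
    (fun κ : {κ : V → ℤ // G.IsProper κ} => ∑ x : V, Finsupp.single (κ.1 x) 1)
    ((Fintype.piFinset fun _ : V => S).subtype G.IsProper) fun κ => ?_)
  · have e1 : ∀ κ : {κ : V → ℤ // G.IsProper κ},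
        (∑ x : V, Finsupp.single (κ.1 x) 1 : ℤ →₀ ℕ).prod (fun j n => specialPoint t k j ^ n) =
          ∏ x, specialPoint t k (κ.1 x) := fun κ => by
      rw [← Finsupp.prod_finsetSum_index (by simp) (by simp [pow_add])]
      simp
    rw [Finset.sum_congr rfl fun κ _ => e1 κ,
      Finset.sum_subtype_eq_sum_filter (p := G.IsProper) (fun κ : V → ℤ => ∏ x, specialPoint t k (κ x)),
      ← Finset.sum_fiberwise _ fun κ : V → ℤ => Finset.univ.filter fun x => κ x = (k : ℤ) + 1]
    refine Finset.sum_congr rfl fun U _ => ?_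
    have e2 : ∀ κ ∈ ((Fintype.piFinset fun _ : V => S).filter G.IsProper).filter
        (fun κ => (Finset.univ.filter fun x => κ x = (k : ℤ) + 1) = U),
        ∏ x, specialPoint t k (κ x) = (t - 1) ^ U.card * (-1) ^ Fintype.card {x // x ∉ U} := by
      intro κ hκ
      have hU := (Finset.mem_filter.1 hκ).2
      have hU' : ∀ x, κ x = k + 1 ↔ x ∈ U := fun x => by simp [← hU]
      rw [← Finset.prod_mul_prod_compl U]
      congr 1
      · rw [Finset.prod_congr rfl fun x hx => by rw [specialPoint, if_pos ((hU' x).2 hx)],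
          Finset.prod_const]
      · rw [Finset.prod_congr (g := fun _ => (-1 : ℚ)) rfl fun x hx => by
          rw [specialPoint, if_neg (mt (hU' x).1 (Finset.mem_compl.1 hx))], Finset.prod_const,
          Fintype.card_subtype]
        congr 2
        ext x
        simp
    rw [Finset.sum_congr rfl e2, Finset.sum_const, nsmul_eq_mul]
    have e3 : (((Fintype.piFinset fun _ : V => S).filter G.IsProper).filter
        (fun κ => (Finset.univ.filter fun x => κ x = (k : ℤ) + 1) = U)).card =
          if G.PosIndependent U then
            boxCount (G.leftPoint U) (G.rightPoint U) (G.remainingEdges U) k else 0 := by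
      rw [← card_proper_colorings]
      refine (Nat.subtype_card _ fun κ => ?_).symm
      simp only [Finset.mem_filter, Fintype.mem_piFinset, and_assoc, Finset.ext_iff,
        Finset.mem_univ, true_and]
      rfl
    rw [e3]
    split_ifs
    · ring
    · simp
  · rw [Finset.mem_subtype, Fintype.mem_piFinset, hsupp]

open Classical in
/-- The sum over the sets `U` counts the acyclic orientations with a weight for every choice of a
set of sinks, and these weights add up to `t` to the number of sinks. -/
theorem sum_regions_eq (t : ℚ) :
    ∑ U : Finset V, (if G.PosIndependent U then (t - 1) ^ U.card *
        ((regions (G.leftPoint U) (G.rightPoint U) (G.remainingEdges U)).card : ℚ) else 0) =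
      ∑ k ∈ Finset.range (Fintype.card V + 1), (G.numAcyclic k : ℚ) * t ^ k := by
  have := Fintype.ofFinite G.Orientation
  have e1 : ∀ U : Finset V, (if G.PosIndependent U then (t - 1) ^ U.card *
        ((regions (G.leftPoint U) (G.rightPoint U) (G.remainingEdges U)).card : ℚ) else 0) =
      ∑ O : G.Orientation, if O.IsAcyclic ∧ ∀ x ∈ U, O.IsSink x then (t - 1) ^ U.card else 0 := by
    intro U
    have h := G.card_acyclic_sinks (U := U)
    rw [Nat.card_eq_fintype_card, Fintype.card_subtype] at h
    rw [← Finset.sum_filter, Finset.sum_const, h, nsmul_eq_mul]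
    split_ifs
    · ring
    · simp
  rw [Finset.sum_congr rfl fun U _ => e1 U, Finset.sum_comm]
  have e2 : ∀ O : G.Orientation,
      (∑ U : Finset V, if O.IsAcyclic ∧ ∀ x ∈ U, O.IsSink x then (t - 1) ^ U.card else 0) =
        if O.IsAcyclic then t ^ Nat.card {x // O.IsSink x} else 0 := by
    intro O
    split_ifs with hO
    · have h : (Finset.univ.filter fun U : Finset V => ∀ x ∈ U, O.IsSink x) =
          (Finset.univ.filter fun x => O.IsSink x).powerset := by
        ext U
        simp [Finset.subset_iff]
      simp only [hO, true_and]
      rw [← Finset.sum_filter, h, Nat.card_eq_fintype_card, Fintype.card_subtype]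
      have := Finset.sum_pow_mul_eq_add_pow (t - 1) 1 (Finset.univ.filter fun x => O.IsSink x)
      simpa using this
    · simp [hO]
  rw [Finset.sum_congr rfl fun O _ => e2 O, ← Finset.sum_filter,
    ← Finset.sum_fiberwise_of_maps_to (t := Finset.range (Fintype.card V + 1))
      (g := fun O : G.Orientation => Nat.card {x // O.IsSink x})]
  · refine Finset.sum_congr rfl fun k _ => ?_
    rw [Finset.sum_congr (g := fun _ => t ^ k) rfl fun O hO => by rw [(Finset.mem_filter.1 hO).2],
      Finset.sum_const, nsmul_eq_mul, Finset.filter_filter, numAcyclic, Nat.card_eq_fintype_card,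
      Fintype.card_subtype]
  · intro O _
    rw [Finset.mem_range, Nat.lt_succ_iff, ← Nat.card_eq_fintype_card]
    exact Finite.card_subtype_le _

/-- The identity between the two generating functions in the number of sinks. -/
theorem sum_coeff_eq (t : ℚ) {F : MvPolynomial Gen ℚ}
    (hF : MvPolynomial.aeval Gen.toSeries F = G.chromaticB) :
    ∑ m ∈ F.support, F.coeff m * t ^ eFactors m =
      ∑ k ∈ Finset.range (Fintype.card V + 1), (G.numAcyclic k : ℚ) * t ^ k := by
  classical
  rw [← eval_specialPoly, ← eval_aeval_specialPoly, ← sum_regions_eq]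
  choose Q hQ hQ' using fun U : Finset V => exists_polynomial_boxCount (G.remainingEdges U)
    {x // x ∉ U} (G.leftPoint U) (G.rightPoint U)
  let R : Polynomial ℚ := ∑ U : Finset V, if G.PosIndependent U then
    Polynomial.C ((t - 1) ^ U.card * (-1) ^ Fintype.card {x // x ∉ U}) * Q U else 0
  have hR : ∀ r, R.eval r = ∑ U : Finset V, if G.PosIndependent U then
      (t - 1) ^ U.card * (-1) ^ Fintype.card {x // x ∉ U} * (Q U).eval r else 0 := fun r => by
    rw [Polynomial.eval_finsetSum]
    refine Finset.sum_congr rfl fun U _ => ?_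
    split_ifs <;> simp
  have h := eval_neg_one_eq_zero (Q := MvPolynomial.aeval (specialPoly t) F - R) fun k => by
    have h1 := HasValue.aeval (hasValue_toSeries t k) F
    rw [hF] at h1
    rw [Polynomial.eval_sub, eval_aeval_specialPoly, h1.unique (G.hasValue_chromaticB t k), hR,
      sub_eq_zero]
    exact Finset.sum_congr rfl fun U _ => by rw [hQ]
  rw [Polynomial.eval_sub, sub_eq_zero, hR] at h
  rw [h]
  refine Finset.sum_congr rfl fun U _ => ?_
  split_ifs
  · rw [hQ', mul_assoc, ← mul_assoc ((-1) ^ _), ← mul_pow]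
    simp
  · rfl

end SignedGraph

theorem theorem3p1 {V : Type u} {E : Type v} [Fintype V] [Finite E] (G : SignedGraph V E) :
    (∃! F : MvPolynomial BSymmetric.Gen ℚ,
      MvPolynomial.aeval BSymmetric.Gen.toSeries F = G.chromaticB) ∧
    ∀ F : MvPolynomial BSymmetric.Gen ℚ,
      MvPolynomial.aeval BSymmetric.Gen.toSeries F = G.chromaticB →
      ∀ k : ℕ, (G.numAcyclic k : ℚ) = BSymmetric.coeffSum F k := by
  classical
  have := Fintype.ofFinite E
  constructor
  · obtain ⟨F, hF⟩ := G.chromaticB_mem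
    exact ⟨F, hF, fun F' hF' => BSymmetric.aeval_toSeries_injective (hF'.trans hF.symm)⟩
  · intro F hF k
    have h : ∑ m ∈ F.support, Polynomial.C (F.coeff m) * Polynomial.X ^ BSymmetric.eFactors m =
        ∑ k ∈ Finset.range (Fintype.card V + 1),
          Polynomial.C (G.numAcyclic k : ℚ) * Polynomial.X ^ k := by
      refine Polynomial.funext fun t => ?_
      simp only [Polynomial.eval_finsetSum, Polynomial.eval_mul, Polynomial.eval_C,
        Polynomial.eval_pow, Polynomial.eval_X]
      exact G.sum_coeff_eq t hF
    have hk := congrArg (fun P => Polynomial.coeff P k) h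
    simp only [Polynomial.finsetSum_coeff, Polynomial.coeff_C_mul_X_pow] at hk
    rw [BSymmetric.coeffSum, Finset.sum_filter, Finset.sum_congr rfl fun m _ => ?_, hk]
    · rw [Finset.sum_ite_eq]
      split_ifs with h'
      · rfl
      · rw [G.numAcyclic_eq_zero, Nat.cast_zero]
        rw [Finset.mem_range] at h'
        omega
    · simp only [eq_comm]
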